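/- There is an absolute constant $C$ such that the following holds for every finite directed graph $G$ and every integer $k\ge 0$. A feedback vertex set of $G$ is a set of vertices that meets every directed cycle of $G$. Let $p\in\{2,3,4\}$ and suppose that $G$ does not contain a family of $k$ distinct directed cycles such that every vertex of $G$ is contained in at most $p$ cycles of the family. (a) If $p=4$, then $G$ has a feedback vertex set of size at most $C k^4$. (b) If $p=3$, then $G$ has a feedback vertex set of size at most $C k^5$. (c) If $p=2$, then $G$ has a feedback vertex set of size at most $C k^6$. For $k=0$ the hypothesis never holds, since the empty family qualifies. -/

import Mathlib

namespace Digraph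

variable {V : Type*}

/-- A directed cycle of `G`: a nonempty cyclic sequence of pairwise distinct vertices (a list up to
rotation) with an arc of `G` from each vertex to the next one, and from the last to the first.
A loop counts as a cycle of length one, a pair of opposite arcs as a cycle of length two. -/
structure IsDirectedCycle (G : Digraph V) (c : Cycle V) : Prop where
  ne_nil : c ≠ Cycle.nil
  nodup : c.Nodup
  chain : c.Chain G.Adj

/-- `G` contains a family of `k` (distinct) directed cycles such that every vertex of `G` is
contained in at most `p` cycles of the family. -/
def HasCyclePacking (G : Digraph V) (p k : ℕ) : Prop :=
  ∃ F : Finset (Cycle V), F.card = k ∧ (∀ c ∈ F, G.IsDirectedCycle c) ∧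
    ∀ v : V, {c : Cycle V | c ∈ F ∧ v ∈ c}.ncard ≤ p

/-- `X` is a feedback vertex set of `G`: it meets every directed cycle of `G`. -/
def IsFeedbackVertexSet (G : Digraph V) (X : Finset V) : Prop :=
  ∀ c : Cycle V, G.IsDirectedCycle c → ∃ v ∈ X, v ∈ c

end Digraph

namespace Digraph

open Relation

variable {V : Type*}

/-! Suppose that a maximum packing has at most `j` cycles, but there is no small feedback vertex
set. By induction on `j`, deleting a small set `X` leaves the vertices on closed walks avoiding `X`
mutually reachable. Otherwise these vertices split along a one-way cut into two parts that both
contain cycles; the packing numbers of the parts add up to at most `j`, and `X` together with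
feedback vertex sets of the parts would be small. So `X ↦ cyclicPart G X` is a haven, and it remains
to show that a haven of large order yields a packing of `k = j + 1` cycles. The induction costs one
factor `j` (`exists_isFeedbackVertexSet`).

A haven forces a path that it cannot be kept away from (`IsHaven.exists_path`). This path is cut
into `16 k` pieces, each an initial stretch `Q t` followed by a stretch `Q' t`. Uncrossing of
separations gives large sets `A t ⊆ Q' t` and `B t ⊆ Q t` linked to and from the haven, and Menger's
theorem (`exists_isLinkage`) then gives disjoint paths from `A t` to `B t` and also back.

If the forward linkages of different pieces meet rarely, `2 k` disjoint linkage paths can be chosen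
from different pieces. Each closes a cycle with its piece of the path, and each vertex lies in at
most one piece and at most one chosen path. If instead two forward linkages meet often, each of them
together with its return linkage is arranged as a thread, which runs through the linkage paths in a
linear order with few breaks. A dense set of meetings contains many separated decreasing pairs
(`exists_decreasing_boxes`), and at each of them the two threads close a cycle. Forward and return
paths of both threads are four layers, so `p = 4` follows from density `O(k)`
(`hasCyclePacking_four`). For `p = 2`, each thread is first cut at `O(k)` positions into segments
without cycles; inside a segment, distant parts of a thread are fully disjoint, so two layers
suffice, at density `O(k ^ 2)` (`hasCyclePacking_two`). The resulting exponents are 4 for `p = 4`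
and 5 for both `p = 3` and `p = 2`. -/

/-! ### Walks, cycles and packings -/

/-- The relation `r` restricted to the vertex set `S`. -/
def within (r : V → V → Prop) (S : Set V) (a b : V) : Prop := r a b ∧ a ∈ S ∧ b ∈ S

/-- `u` reaches `v` by a walk of `r` whose steps stay in `S`. -/
def ReachIn (r : V → V → Prop) (S : Set V) : V → V → Prop := ReflTransGen (within r S)

/-- Some directed cycle of `G` has all its vertices in `S`. -/
def HasCycleIn (G : Digraph V) (S : Set V) : Prop :=
  ∃ c : Cycle V, G.IsDirectedCycle c ∧ ∀ v ∈ c, v ∈ S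

theorem within_mono {r : V → V → Prop} {S T : Set V} (h : S ⊆ T) : within r S ≤ within r T :=
  fun _ _ hab => ⟨hab.1, h hab.2.1, h hab.2.2⟩

theorem ReachIn.refl {r : V → V → Prop} {S : Set V} (v : V) : ReachIn r S v v := ReflTransGen.refl

theorem ReachIn.trans {r : V → V → Prop} {S : Set V} {u v w : V} (h : ReachIn r S u v)
    (h' : ReachIn r S v w) : ReachIn r S u w := ReflTransGen.trans h h'

theorem ReachIn.mono {r : V → V → Prop} {S T : Set V} (h : S ⊆ T) {u v : V}
    (huv : ReachIn r S u v) : ReachIn r T u v :=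
  ReflTransGen.mono (within_mono h) _ _ huv

theorem ReachIn.flip {r : V → V → Prop} {S : Set V} {u v : V} (h : ReachIn r S u v) :
    ReachIn (fun a b => r b a) S v u := by
  induction h with
  | refl => exact ReflTransGen.refl
  | tail _ hbc ih => exact ReflTransGen.head ⟨hbc.1, hbc.2.2, hbc.2.1⟩ ih

theorem ReachIn.mem {r : V → V → Prop} {S : Set V} {u v : V} (h : ReachIn r S u v) (hu : u ∈ S) :
    v ∈ S := by
  induction h with
  | refl => exact hu
  | tail _ hbc _ => exact hbc.2.2

/-- A walk that starts in a set either ends in it or uses a step that leaves it. -/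
theorem ReachIn.mem_of_closed {r : V → V → Prop} {S R : Set V} {u v : V} (h : ReachIn r S u v)
    (hu : u ∈ R) (hR : ∀ a b, r a b → a ∈ S → b ∈ S → a ∈ R → b ∈ R) : v ∈ R := by
  induction h with
  | refl => exact hu
  | tail _ hbc ih => exact hR _ _ hbc.1 hbc.2.1 hbc.2.2 ih

theorem ReachIn.transGen {r : V → V → Prop} {S : Set V} {u v : V} (h : ReachIn r S u v)
    (hne : u ≠ v) : TransGen (within r S) u v :=
  (reflTransGen_iff_eq_or_transGen.1 h).resolve_left (Ne.symm hne)

theorem HasCycleIn.mono {G : Digraph V} {S T : Set V} (h : S ⊆ T) (hS : G.HasCycleIn S) :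
    G.HasCycleIn T := by
  obtain ⟨c, hc, hcS⟩ := hS
  exact ⟨c, hc, fun v hv => h (hcS v hv)⟩

/-- A shortest closed walk in `S`, over all base points, repeats no vertex, since a repetition would
cut out a shorter closed walk. All later cycles are produced as closed walks through this lemma. -/
theorem hasCycleIn_of_transGen {G : Digraph V} {S : Set V} {v : V}
    (h : TransGen (within G.Adj S) v v) : G.HasCycleIn S := by
  classical
  have hex : ∃ n : ℕ, ∃ (v : V) (l : List V), l.length = n ∧
      List.IsChain (within G.Adj S) (v :: (l ++ [v])) := by
    obtain ⟨b, hvb, hbv⟩ := TransGen.tail'_iff.1 h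
    obtain ⟨l, hl, hlast⟩ := List.exists_isChain_cons_of_relationReflTransGen hvb
    refine ⟨_, v, l, rfl, ?_⟩
    rw [← List.cons_append]
    refine List.IsChain.append hl (List.isChain_singleton v) ?_
    intro x hx y hy
    rw [List.getLast?_eq_getLast_of_ne_nil (List.cons_ne_nil _ _), hlast] at hx
    simp at hx hy
    subst hx hy
    exact hbv
  obtain ⟨v, l, hlen, hl⟩ := Nat.find_spec hex
  have hmin := fun m hm => Nat.find_min hex (m := m) hm
  rw [← hlen] at hmin
  refine ⟨((v :: l : List V) : Cycle V), ⟨?_, ?_, ?_⟩, ?_⟩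
  · intro h0
    simp at h0
  · rw [Cycle.nodup_coe_iff, List.nodup_iff_sublist]
    intro x hx
    rw [List.cons_sublist_iff] at hx
    obtain ⟨r₁, r₂, hr, hx1, hx2⟩ := hx
    rw [List.singleton_sublist] at hx2
    obtain ⟨s, t, rfl⟩ := List.append_of_mem hx1
    obtain ⟨t', u, rfl⟩ := List.append_of_mem hx2
    have hlen2 := congrArg List.length hr
    simp at hlen2
    refine hmin (t ++ t').length (by simp; omega) ⟨x, t ++ t', rfl, hl.infix ?_⟩
    refine ⟨s, u ++ [v], ?_⟩
    rw [show v :: (l ++ [v]) = (v :: l) ++ [v] from rfl, hr]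
    simp
  · rw [Cycle.chain_coe_cons]
    exact hl.imp fun a b hab => hab.1
  · intro w hw
    have hch : Cycle.Chain (fun a _ => a ∈ S) ((v :: l : List V) : Cycle V) := by
      rw [Cycle.chain_coe_cons]
      exact hl.imp fun a b hab => hab.2.1
    have : IsTrans V (fun a _ => a ∈ S) := ⟨fun a _ _ h _ => h⟩
    exact Cycle.chain_iff_pairwise.1 hch w hw w hw

theorem IsDirectedCycle.chain_within {G : Digraph V} {c : Cycle V} (hc : G.IsDirectedCycle c)
    {S : Set V} (hS : ∀ v ∈ c, v ∈ S) : c.Chain (within G.Adj S) := by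
  have hch := hc.chain
  clear hc
  induction c with
  | nil => trivial
  | cons a l =>
    rw [Cycle.chain_coe_cons] at hch ⊢
    refine hch.imp_of_mem_imp fun x y hx hy hxy => ⟨hxy, hS x ?_, hS y ?_⟩
    all_goals simp at hx hy ⊢; tauto

theorem IsDirectedCycle.transGen {G : Digraph V} {c : Cycle V} (hc : G.IsDirectedCycle c)
    {S : Set V} (hS : ∀ v ∈ c, v ∈ S) {u v : V} (hu : u ∈ c) (hv : v ∈ c) :
    TransGen (within G.Adj S) u v :=
  Cycle.chain_iff_pairwise.1 ((hc.chain_within hS).imp fun _ _ => TransGen.single) u hu v hv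

/-- The arcs of `G` with both ends in `U`. -/
def restrict (G : Digraph V) (U : Set V) : Digraph V := ⟨within G.Adj U⟩

theorem isDirectedCycle_restrict {G : Digraph V} {U : Set V} {c : Cycle V} :
    (G.restrict U).IsDirectedCycle c ↔ G.IsDirectedCycle c ∧ ∀ v ∈ c, v ∈ U := by
  constructor
  · intro h
    refine ⟨⟨h.ne_nil, h.nodup, h.chain.imp fun _ _ hab => hab.1⟩, fun v hv => ?_⟩
    have : IsTrans V (fun a _ => a ∈ U) := ⟨fun a _ _ h _ => h⟩
    exact Cycle.chain_iff_pairwise.1 (h.chain.imp (r₂ := fun a _ => a ∈ U) fun _ _ hab => hab.2.1)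
      v hv v hv
  · rintro ⟨h, hU⟩
    exact ⟨h.ne_nil, h.nodup, h.chain_within hU⟩

theorem IsDirectedCycle.exists_mem {G : Digraph V} {c : Cycle V} (hc : G.IsDirectedCycle c) :
    ∃ v, v ∈ c := by
  have h := hc.ne_nil
  induction c with
  | nil => exact absurd rfl h
  | cons a l => exact ⟨a, by simp⟩

theorem HasCyclePacking.mono {G : Digraph V} {p q k l : ℕ} (hpq : p ≤ q) (hlk : l ≤ k)
    (h : G.HasCyclePacking p k) : G.HasCyclePacking q l := by
  obtain ⟨F, hF, hc, hv⟩ := h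
  obtain ⟨F', hF', hcard⟩ := Finset.exists_subset_card_eq (hlk.trans hF.ge)
  refine ⟨F', hcard, fun c hc' => hc c (hF' hc'), fun v => le_trans ?_ ((hv v).trans hpq)⟩
  exact Set.ncard_le_ncard (fun c hc => ⟨hF' hc.1, hc.2⟩)
    (F.finite_toSet.subset fun c hc => hc.1)

/-- Cycles inside unions of layers that are disjoint within each of the `p` layers form a packing
in which a vertex is used at most `p` times. -/
theorem hasCyclePacking_of_layers {G : Digraph V} {p k : ℕ} (hp : 0 < p) {ι : Type*}
    (T : Finset ι) (Z : Fin p → ι → Set V)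
    (hdisj : ∀ i, ∀ s ∈ T, ∀ t ∈ T, s ≠ t → Disjoint (Z i s) (Z i t))
    (hcyc : ∀ t ∈ T, G.HasCycleIn (⋃ i, Z i t)) (hcard : p * k ≤ T.card) :
    G.HasCyclePacking p k := by
  classical
  have key : ∀ (v : V) (T' : Finset ι), T' ⊆ T → (∀ t ∈ T', v ∈ ⋃ i, Z i t) → T'.card ≤ p := by
    intro v T' hT' hv
    have hv' : ∀ t : T', ∃ i, v ∈ Z i t := fun t => Set.mem_iUnion.1 (hv t t.2)
    choose f hf using hv'
    have hinj : Function.Injective f := by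
      intro s t hst
      by_contra hne
      refine Set.disjoint_left.1 (hdisj (f s) s (hT' s.2) t (hT' t.2) fun h => hne (Subtype.ext h))
        (hf s) ?_
      rw [hst]
      exact hf t
    simpa using Fintype.card_le_of_injective f hinj
  have hcyc' : ∀ t, ∃ c : Cycle V, t ∈ T → G.IsDirectedCycle c ∧ ∀ v ∈ c, v ∈ ⋃ i, Z i t := by
    intro t
    by_cases ht : t ∈ T
    · obtain ⟨c, hc⟩ := hcyc t ht
      exact ⟨c, fun _ => hc⟩
    · exact ⟨Cycle.nil, fun h => absurd h ht⟩
  choose c hc using hcyc'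
  -- Different indices may select the same cycle. A cycle has a vertex, so it is selected at most
  -- `p` times; this is why `p * k` indices are required.
  have hle : k ≤ (T.image c).card := by
    have := Finset.card_le_mul_card_image (f := c) T p fun d hd => by
      obtain ⟨t, ht, rfl⟩ := Finset.mem_image.1 hd
      obtain ⟨v, hv⟩ := (hc t ht).1.exists_mem
      refine key v _ (Finset.filter_subset _ _) fun s hs => ?_
      rw [Finset.mem_filter] at hs
      exact (hc s hs.1).2 v (hs.2 ▸ hv)
    exact Nat.le_of_mul_le_mul_left (hcard.trans this) hp
  refine HasCyclePacking.mono le_rfl hle ⟨T.image c, rfl, ?_, fun v => ?_⟩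
  · intro d hd
    obtain ⟨t, ht, rfl⟩ := Finset.mem_image.1 hd
    exact (hc t ht).1
  · have hset : {d : Cycle V | d ∈ T.image c ∧ v ∈ d} =
        ((T.filter fun t => v ∈ c t).image c : Finset (Cycle V)) := by
      ext d
      simp only [Finset.mem_image, Set.mem_ofPred_eq, Finset.coe_image, Set.mem_image,
        Finset.coe_filter]
      constructor
      · rintro ⟨⟨t, ht, rfl⟩, hv⟩
        exact ⟨t, ⟨ht, hv⟩, rfl⟩
      · rintro ⟨t, ⟨ht, hv⟩, rfl⟩
        exact ⟨⟨t, ht, rfl⟩, hv⟩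
    rw [hset, Set.ncard_coe_finset]
    refine Finset.card_image_le.trans (key v _ (Finset.filter_subset _ _) fun t ht => ?_)
    rw [Finset.mem_filter] at ht
    exact (hc t ht.1).2 v ht.2

/-! ### Havens in graphs without small feedback vertex sets -/

/-- A haven of order `w`: after deleting at most `w` vertices it points to a strongly connected set,
consistently under further deletions. -/
structure IsHaven (r : V → V → Prop) (w : ℕ) (β : Finset V → Set V) : Prop where
  nonempty : ∀ X : Finset V, X.card ≤ w → (β X).Nonempty
  notMem : ∀ X : Finset V, ∀ v ∈ β X, v ∉ X
  anti : ∀ X Y : Finset V, X ⊆ Y → β Y ⊆ β X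
  reach : ∀ X : Finset V, X.card ≤ w → ∀ u ∈ β X, ∀ v ∈ β X, ReachIn r (β X) u v

theorem hasCyclePacking_one {G : Digraph V} {p : ℕ} (hp : 0 < p) {c : Cycle V}
    (hc : G.IsDirectedCycle c) : G.HasCyclePacking p 1 := by
  classical
  refine ⟨{c}, rfl, by simpa using hc, fun v => ?_⟩
  refine le_trans (Set.ncard_le_ncard (t := {c}) (fun d hd => by simpa using hd.1)) ?_
  rw [Set.ncard_singleton]
  exact hp

theorem HasCyclePacking.of_restrict {G : Digraph V} {U : Set V} {p k : ℕ}
    (h : (G.restrict U).HasCyclePacking p k) : G.HasCyclePacking p k := by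
  obtain ⟨F, hF, hc, hv⟩ := h
  exact ⟨F, hF, fun c hcF => (isDirectedCycle_restrict.1 (hc c hcF)).1, hv⟩

theorem HasCyclePacking.add {G : Digraph V} {U W : Set V} (hUW : Disjoint U W) {p k l : ℕ}
    (hU : (G.restrict U).HasCyclePacking p k) (hW : (G.restrict W).HasCyclePacking p l) :
    G.HasCyclePacking p (k + l) := by
  classical
  obtain ⟨F, hF, hFc, hFv⟩ := hU
  obtain ⟨F', hF', hFc', hFv'⟩ := hW
  have h1 : ∀ c ∈ F, ∀ v ∈ c, v ∈ U := fun c hc => (isDirectedCycle_restrict.1 (hFc c hc)).2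
  have h2 : ∀ c ∈ F', ∀ v ∈ c, v ∈ W := fun c hc => (isDirectedCycle_restrict.1 (hFc' c hc)).2
  refine ⟨F ∪ F', ?_, ?_, fun v => ?_⟩
  · rw [Finset.card_union_of_disjoint, hF, hF']
    rw [Finset.disjoint_left]
    intro c hc hc'
    obtain ⟨v, hv⟩ := (hFc c hc).exists_mem
    exact Set.disjoint_left.1 hUW (h1 c hc v hv) (h2 c hc' v hv)
  · intro c hc
    rcases Finset.mem_union.1 hc with hc | hc
    · exact (isDirectedCycle_restrict.1 (hFc c hc)).1
    · exact (isDirectedCycle_restrict.1 (hFc' c hc)).1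
  · by_cases hvU : v ∈ U
    · refine le_trans (Set.ncard_le_ncard ?_ (F.finite_toSet.subset fun c hc => hc.1)) (hFv v)
      rintro c ⟨hc, hvc⟩
      refine ⟨(Finset.mem_union.1 hc).resolve_right fun hc' => ?_, hvc⟩
      exact Set.disjoint_left.1 hUW hvU (h2 c hc' v hvc)
    · refine le_trans (Set.ncard_le_ncard ?_ (F'.finite_toSet.subset fun c hc => hc.1)) (hFv' v)
      rintro c ⟨hc, hvc⟩
      exact ⟨(Finset.mem_union.1 hc).resolve_left fun hc' => hvU (h1 c hc' v hvc), hvc⟩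

theorem exists_max_packing {G : Digraph V} {p j : ℕ} (h1 : G.HasCyclePacking p 1)
    (hj : ¬ G.HasCyclePacking p (j + 1)) :
    ∃ i, 1 ≤ i ∧ G.HasCyclePacking p i ∧ ¬ G.HasCyclePacking p (i + 1) := by
  classical
  have hex : ∃ n, ¬ G.HasCyclePacking p n := ⟨_, hj⟩
  have hs := Nat.find_spec hex
  have h2 : 2 ≤ Nat.find hex := by
    by_contra hlt
    exact hs (h1.mono le_rfl (by omega))
  refine ⟨Nat.find hex - 1, by omega, ?_, ?_⟩
  · exact not_not.1 (Nat.find_min hex (by omega))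
  · rwa [Nat.sub_add_cancel (by omega)]

/-- This is the recursion of the induction on the packing number: one deleted set and two
subproblems. It rests on `2 * j₁ * j₂ ≥ j₁ + j₂`, which needs both parts to be nonzero. -/
theorem add_pow_succ_le {j j₁ j₂ q : ℕ} (h₁ : 1 ≤ j₁) (h₂ : 1 ≤ j₂) (h : j₁ + j₂ ≤ j) :
    j ^ (q + 1) + (j₁ ^ (q + 2) + j₂ ^ (q + 2)) ≤ j ^ (q + 2) := by
  have e1 : j₁ ^ (q + 2) ≤ j₁ ^ 2 * j ^ q := by
    rw [pow_add, mul_comm]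
    exact Nat.mul_le_mul_left _ (Nat.pow_le_pow_left (by omega) q)
  have e2 : j₂ ^ (q + 2) ≤ j₂ ^ 2 * j ^ q := by
    rw [pow_add, mul_comm]
    exact Nat.mul_le_mul_left _ (Nat.pow_le_pow_left (by omega) q)
  have e3 : j + (j₁ ^ 2 + j₂ ^ 2) ≤ j ^ 2 := by
    obtain ⟨a, rfl⟩ := Nat.exists_eq_add_of_le h₁
    obtain ⟨b, rfl⟩ := Nat.exists_eq_add_of_le h₂
    obtain ⟨c, rfl⟩ := Nat.exists_eq_add_of_le h
    nlinarith [Nat.zero_le (a * b), Nat.zero_le (a * c), Nat.zero_le (b * c), Nat.zero_le (c * c)]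
  calc j ^ (q + 1) + (j₁ ^ (q + 2) + j₂ ^ (q + 2))
      ≤ j ^ (q + 1) + (j₁ ^ 2 * j ^ q + j₂ ^ 2 * j ^ q) := by gcongr
    _ = (j + (j₁ ^ 2 + j₂ ^ 2)) * j ^ q := by ring
    _ ≤ j ^ 2 * j ^ q := Nat.mul_le_mul_right _ e3
    _ = j ^ (q + 2) := by ring

/-- The vertices on closed walks avoiding `X`. -/
def cyclicPart (G : Digraph V) (X : Finset V) : Set V :=
  {v | TransGen (within G.Adj (X : Set V)ᶜ) v v}

/-- A walk inside a strongly connected component stays in the component. -/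
theorem ReachIn.component {r : V → V → Prop} {S : Set V} {u v : V} (huv : ReachIn r S u v)
    (hvu : ReachIn r S v u) : ReachIn r {y | ReachIn r S v y ∧ ReachIn r S y v} u v := by
  induction huv using ReflTransGen.head_induction_on with
  | refl => exact ReachIn.refl _
  | head hab hbv ih =>
    have hvb : ReachIn r S v _ := hvu.tail hab
    exact ReflTransGen.head ⟨hab.1, ⟨hvu, ReflTransGen.head hab hbv⟩, ⟨hvb, hbv⟩⟩ (ih hvb)

/-- A vertex mutually reachable with a vertex on a closed walk is itself on a closed walk, so the
connecting walk never leaves the cyclic part. -/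
theorem reachIn_cyclicPart {G : Digraph V} {X : Finset V} {u v : V} (hv : v ∈ G.cyclicPart X)
    (huv : ReachIn G.Adj (X : Set V)ᶜ u v) (hvu : ReachIn G.Adj (X : Set V)ᶜ v u) :
    ReachIn G.Adj (G.cyclicPart X) u v := by
  refine (huv.component hvu).mono ?_
  rintro x ⟨hvx, hxv⟩
  by_cases hx : x = v
  · exact hx ▸ hv
  · exact (hxv.transGen hx).trans_left hvx

theorem hasCycleIn_component {G : Digraph V} {S : Set V} {x : V}
    (hx : TransGen (within G.Adj S) x x) :
    G.HasCycleIn {y | ReachIn G.Adj S x y ∧ ReachIn G.Adj S y x} := by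
  obtain ⟨b, hxb, hbx⟩ := TransGen.head'_iff.1 hx
  have hxb' : ReachIn G.Adj S x b := ReflTransGen.single hxb
  exact hasCycleIn_of_transGen (TransGen.head' ⟨hxb.1, ⟨ReachIn.refl _, ReachIn.refl _⟩,
    ⟨hxb', hbx⟩⟩ (ReachIn.component hbx hxb'))

/-- A feedback vertex set bound from the packings provided by havens. -/
theorem exists_isFeedbackVertexSet [Finite V] {p q C : ℕ} (hp : 0 < p)
    (H : ∀ (G : Digraph V) (β : Finset V → Set V) (j : ℕ), 1 ≤ j →
      IsHaven G.Adj (C * j ^ (q + 1)) β → G.HasCyclePacking p (j + 1))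
    (j : ℕ) (G : Digraph V) (hG : ¬ G.HasCyclePacking p (j + 1)) :
    ∃ X : Finset V, G.IsFeedbackVertexSet X ∧ X.card ≤ C * j ^ (q + 2) := by
  classical
  induction j using Nat.strong_induction_on generalizing G with
  | _ j ih =>
  rcases Nat.eq_zero_or_pos j with rfl | hj
  · exact ⟨∅, fun c hc => absurd (hasCyclePacking_one hp hc) hG, by simp⟩
  by_contra hno
  push Not at hno
  refine hG (H G G.cyclicPart j hj ⟨?_, ?_, ?_, ?_⟩)
  · intro X hX
    have hX' : ¬ G.IsFeedbackVertexSet X := fun h => by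
      have h1 := hno X h
      have h2 : C * j ^ (q + 1) ≤ C * j ^ (q + 2) :=
        Nat.mul_le_mul_left _ (Nat.pow_le_pow_right hj (by omega))
      omega
    unfold IsFeedbackVertexSet at hX'
    push Not at hX'
    obtain ⟨c, hc, hcX⟩ := hX'
    obtain ⟨v, hv⟩ := hc.exists_mem
    exact ⟨v, hc.transGen (fun u hu hu' => hcX u hu' hu) hv hv⟩
  · intro X v hv
    obtain ⟨b, hvb, -⟩ := TransGen.head'_iff.1 hv
    exact hvb.2.1
  · intro X Y hXY v hv
    exact TransGen.mono (within_mono (by simpa using hXY)) _ _ hv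
  · intro X hX
    have key : ∀ u ∈ G.cyclicPart X, ∀ v ∈ G.cyclicPart X, ReachIn G.Adj (X : Set V)ᶜ u v := by
      intro u hu v hv
      by_contra huv
      -- No arc avoiding `X` leaves `R`, so every cycle avoiding `X` lies in `R` or in its
      -- complement. Both sides contain a cycle, at `u` and at `v`, so both packing numbers are
      -- positive and hence smaller than `j`.
      set R : Set V := {x | ReachIn G.Adj (X : Set V)ᶜ u x} with hR
      have step : ∀ a b, a ∈ R → ReachIn G.Adj (X : Set V)ᶜ a b → b ∈ R :=
        fun a b ha hab => ReachIn.trans ha hab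
      have hcyc : ∀ (U : Set V) (x : V), x ∈ G.cyclicPart X →
          (∀ y, ReachIn G.Adj (X : Set V)ᶜ x y → ReachIn G.Adj (X : Set V)ᶜ y x → y ∈ U) →
          (G.restrict U).HasCyclePacking p 1 := by
        intro U x hx hU
        obtain ⟨c, hc, hcU⟩ := hasCycleIn_component hx
        exact hasCyclePacking_one hp (isDirectedCycle_restrict.2
          ⟨hc, fun y hy => hU y (hcU y hy).1 (hcU y hy).2⟩)
      have hRone := hcyc R u hu fun y hy _ => hy
      have hRcone := hcyc Rᶜ v hv fun y _ hy hyR => huv (step y v hyR hy)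
      have hmax : ∀ U, ¬ (G.restrict U).HasCyclePacking p (j + 1) := fun U h => hG h.of_restrict
      obtain ⟨j₁, hj₁, hp₁, hn₁⟩ := exists_max_packing hRone (hmax R)
      obtain ⟨j₂, hj₂, hp₂, hn₂⟩ := exists_max_packing hRcone (hmax Rᶜ)
      have hsum : j₁ + j₂ ≤ j := by
        by_contra hlt
        exact hG ((hp₁.add disjoint_compl_right hp₂).mono le_rfl (by omega))
      obtain ⟨X₁, hX₁, hc₁⟩ := ih j₁ (by omega) _ hn₁
      obtain ⟨X₂, hX₂, hc₂⟩ := ih j₂ (by omega) _ hn₂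
      have hfvs : G.IsFeedbackVertexSet (X ∪ (X₁ ∪ X₂)) := by
        intro c hc
        by_cases hcX : ∃ v ∈ X, v ∈ c
        · obtain ⟨v, hv, hvc⟩ := hcX
          exact ⟨v, by simp [hv], hvc⟩
        push Not at hcX
        have hreach : ∀ a ∈ c, ∀ b ∈ c, ReachIn G.Adj (X : Set V)ᶜ a b := fun a ha b hb =>
          (hc.transGen (fun x hx hx' => hcX x hx' hx) ha hb).to_reflTransGen
        by_cases hcR : ∃ a ∈ c, a ∈ R
        · obtain ⟨a, ha, haR⟩ := hcR
          obtain ⟨x, hx, hxc⟩ := hX₁ c (isDirectedCycle_restrict.2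
            ⟨hc, fun b hb => step a b haR (hreach a ha b hb)⟩)
          exact ⟨x, by simp [hx], hxc⟩
        · push Not at hcR
          obtain ⟨x, hx, hxc⟩ := hX₂ c (isDirectedCycle_restrict.2 ⟨hc, hcR⟩)
          exact ⟨x, by simp [hx], hxc⟩
      have hlt := hno _ hfvs
      have hle : (X ∪ (X₁ ∪ X₂)).card ≤ X.card + (X₁.card + X₂.card) :=
        (Finset.card_union_le _ _).trans (Nat.add_le_add_left (Finset.card_union_le _ _) _)
      have hpow := Nat.mul_le_mul_left C (add_pow_succ_le (q := q) hj₁ hj₂ hsum)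
      rw [mul_add, mul_add] at hpow
      omega
    intro u hu v hv
    exact reachIn_cyclicPart hv (key u hu v hv) (key v hv u hu)

/-! ### Menger's theorem -/

/-- The vertices of `R` that lie in `B` or have an out-neighbour outside `R`. -/
def boundary (r : V → V → Prop) (B R : Set V) : Set V :=
  {v | v ∈ R ∧ (v ∈ B ∨ ∃ w, w ∉ R ∧ r v w)}

/-- Disjoint paths from all vertices of `A` to `B`. The path from `a` is given by its vertex set
`S a` and its last vertex `e a`. -/
structure IsLinkage (r : V → V → Prop) (A B : Finset V) (S : V → Set V) (e : V → V) : Prop where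
  start_mem : ∀ a ∈ A, a ∈ S a
  end_mem : ∀ a ∈ A, e a ∈ S a
  end_target : ∀ a ∈ A, e a ∈ B
  reach_start : ∀ a ∈ A, ∀ v ∈ S a, ReachIn r (S a) a v
  reach_end : ∀ a ∈ A, ∀ v ∈ S a, ReachIn r (S a) v (e a)
  disjoint : ∀ a ∈ A, ∀ a' ∈ A, a ≠ a' → Disjoint (S a) (S a')

/-- Removing the arc `x y` from a minimal relation violates the bound at some `R`. Only `x` can have
left the boundary of `R`, and only because `x y` was its sole reason to be there. -/
theorem boundary_critical {A B : Set V} {n : ℕ} {r : V → V → Prop} [Finite V]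
    (hr : Minimal (fun m : V → V → Prop => ∀ R : Set V, A ⊆ R → n ≤ (boundary m B R).ncard) r)
    {x y : V} (hxy : r x y) :
    ∃ R : Set V, A ⊆ R ∧ x ∈ R ∧ y ∉ R ∧ x ∉ B ∧ (∀ w, r x w → w ≠ y → w ∈ R) ∧
      (boundary r B R \ {x}).ncard < n := by
  classical
  let m : V → V → Prop := fun a b => r a b ∧ ¬ (a = x ∧ b = y)
  have hmr : m ≤ r := fun a b h => h.1
  have hnot : ¬ ∀ R : Set V, A ⊆ R → n ≤ (boundary m B R).ncard := by
    intro h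
    exact (hr.2 h hmr x y hxy).2 ⟨rfl, rfl⟩
  push Not at hnot
  obtain ⟨R, hAR, hR⟩ := hnot
  have hle := hr.1 R hAR
  have hsub : boundary r B R ⊆ insert x (boundary m B R) := by
    rintro v ⟨hv, hv'⟩
    by_cases hvx : v = x
    · exact Or.inl hvx
    · refine Or.inr ⟨hv, hv'.imp_right ?_⟩
      rintro ⟨w, hw, hvw⟩
      exact ⟨w, hw, hvw, fun h => hvx h.1⟩
  have hx : x ∉ boundary m B R := by
    intro hx
    rw [Set.insert_eq_of_mem hx] at hsub
    have := Set.ncard_le_ncard hsub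
    omega
  have hxR : x ∈ R ∧ y ∉ R := by
    by_contra hcon
    have : boundary r B R ⊆ boundary m B R := by
      rintro v ⟨hv, hv'⟩
      refine ⟨hv, hv'.imp_right ?_⟩
      rintro ⟨w, hw, hvw⟩
      refine ⟨w, hw, hvw, ?_⟩
      rintro ⟨rfl, rfl⟩
      exact hcon ⟨hv, hw⟩
    have := Set.ncard_le_ncard this
    omega
  refine ⟨R, hAR, hxR.1, hxR.2, fun hB => hx ⟨hxR.1, Or.inl hB⟩, fun w hw hwy => ?_, ?_⟩
  · by_contra hwR
    exact hx ⟨hxR.1, Or.inr ⟨w, hwR, hw, fun h => hwy h.2⟩⟩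
  · refine lt_of_le_of_lt (Set.ncard_le_ncard ?_) hR
    rintro v ⟨hv, hvx⟩
    exact (hsub hv).resolve_left hvx

/-- Uncrossing: for two arcs from `x`, take the critical sets `R₁` and `R₂`. Each contains the head
of the other arc, so `x` is not in the boundary of the union. Hence the boundaries of union and
intersection have total size at most `2 * (n - 1) + 1`, while both are at least `n`. -/
theorem rightUnique_of_minimal_boundary {A B : Set V} {n : ℕ} {r : V → V → Prop} [Finite V]
    (hr : Minimal (fun m : V → V → Prop => ∀ R : Set V, A ⊆ R → n ≤ (boundary m B R).ncard) r) :
    Relator.RightUnique r := by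
  intro x y₁ y₂ h₁ h₂
  by_contra hne
  obtain ⟨R₁, hA₁, hx₁, hy₁, hB, hw₁, hn₁⟩ := boundary_critical hr h₁
  obtain ⟨R₂, hA₂, hx₂, hy₂, -, hw₂, hn₂⟩ := boundary_critical hr h₂
  have hi := hr.1 (R₁ ∩ R₂) (Set.subset_inter hA₁ hA₂)
  have hu := hr.1 (R₁ ∪ R₂) (hA₁.trans Set.subset_union_left)
  set D₁ := boundary r B R₁ \ {x}
  set D₂ := boundary r B R₂ \ {x}
  have hxu : x ∉ boundary r B (R₁ ∪ R₂) := by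
    rintro ⟨-, h | ⟨w, hw, hxw⟩⟩
    · exact hB h
    · refine hw ?_
      by_cases hwy : w = y₁
      · exact Or.inr (hw₂ w hxw (hwy ▸ hne))
      · exact Or.inl (hw₁ w hxw hwy)
  have e1 : boundary r B (R₁ ∪ R₂) ∪ boundary r B (R₁ ∩ R₂) ⊆ insert x (D₁ ∪ D₂) := by
    intro v hv
    by_cases hvx : v = x
    · exact Or.inl hvx
    refine Or.inr ?_
    rcases hv with ⟨hv, hv'⟩ | ⟨⟨hv1, hv2⟩, hv'⟩
    · rcases hv with hv | hv
      · refine Or.inl ⟨⟨hv, hv'.imp_right ?_⟩, hvx⟩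
        rintro ⟨w, hw, hvw⟩
        exact ⟨w, fun h => hw (Or.inl h), hvw⟩
      · refine Or.inr ⟨⟨hv, hv'.imp_right ?_⟩, hvx⟩
        rintro ⟨w, hw, hvw⟩
        exact ⟨w, fun h => hw (Or.inr h), hvw⟩
    · rcases hv' with hv' | ⟨w, hw, hvw⟩
      · exact Or.inl ⟨⟨hv1, Or.inl hv'⟩, hvx⟩
      · by_cases hwR : w ∈ R₁
        · exact Or.inr ⟨⟨hv2, Or.inr ⟨w, fun h => hw ⟨hwR, h⟩, hvw⟩⟩, hvx⟩
        · exact Or.inl ⟨⟨hv1, Or.inr ⟨w, hwR, hvw⟩⟩, hvx⟩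
  have e2 : boundary r B (R₁ ∪ R₂) ∩ boundary r B (R₁ ∩ R₂) ⊆ D₁ ∩ D₂ := by
    rintro v ⟨⟨hv, hv'⟩, ⟨⟨hv1, hv2⟩, -⟩⟩
    have hvx : v ≠ x := by
      rintro rfl
      exact hxu ⟨hv, hv'⟩
    refine ⟨⟨⟨hv1, hv'.imp_right ?_⟩, hvx⟩, ⟨⟨hv2, hv'.imp_right ?_⟩, hvx⟩⟩
    · rintro ⟨w, hw, hvw⟩
      exact ⟨w, fun h => hw (Or.inl h), hvw⟩
    · rintro ⟨w, hw, hvw⟩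
      exact ⟨w, fun h => hw (Or.inr h), hvw⟩
  have c1 := (Set.ncard_le_ncard e1).trans (Set.ncard_insert_le _ _)
  have c2 := Set.ncard_le_ncard e2
  have c3 := Set.ncard_union_add_ncard_inter (boundary r B (R₁ ∪ R₂)) (boundary r B (R₁ ∩ R₂))
  have c4 := Set.ncard_union_add_ncard_inter D₁ D₂
  omega

theorem le_boundary_of_reach [Finite V] {r : V → V → Prop} {A B : Finset V}
    (h : ∀ X : Finset V, X.card < A.card →
      ∃ a ∈ A, ∃ b ∈ B, a ∉ X ∧ ReachIn r (X : Set V)ᶜ a b) (R : Set V) (hR : (A : Set V) ⊆ R) :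
    A.card ≤ (boundary r B R).ncard := by
  classical
  by_contra! hlt
  have hfin := Set.toFinite (boundary r (B : Set V) R)
  rw [Set.ncard_eq_toFinset_card _ hfin] at hlt
  obtain ⟨a, ha, b, hb, haX, hab⟩ := h _ hlt
  have hclosed := hab.mem_of_closed (R := R) (hR ha) fun c d hcd hc hd hcR => by
    by_contra hdR
    refine hc ?_
    simp only [Set.Finite.coe_toFinset]
    exact ⟨hcR, Or.inr ⟨d, hdR, hcd⟩⟩
  have hbX := hab.mem (by simpa using haX)
  refine hbX ?_
  simp only [Set.Finite.coe_toFinset]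
  exact ⟨hclosed, Or.inl hb⟩

theorem reach_of_le_boundary [Finite V] {r : V → V → Prop} {A B : Finset V}
    (h : ∀ R : Set V, (A : Set V) ⊆ R → A.card ≤ (boundary r B R).ncard) (X : Finset V)
    (hX : X.card < A.card) : ∃ a ∈ A, ∃ b ∈ B, a ∉ X ∧ ReachIn r (X : Set V)ᶜ a b := by
  classical
  by_contra! hno
  have h1 := h (X ∪ {v | ∃ a ∈ A, a ∉ X ∧ ReachIn r (X : Set V)ᶜ a v}) (fun a ha => by
    by_cases haX : a ∈ X
    · exact Or.inl haX
    · exact Or.inr ⟨a, ha, haX, ReachIn.refl _⟩)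
  have h2 : boundary r B (X ∪ {v | ∃ a ∈ A, a ∉ X ∧ ReachIn r (X : Set V)ᶜ a v}) ⊆ X := by
    rintro v ⟨hv, hv'⟩
    rcases hv with hv | ⟨a, ha, haX, hav⟩
    · exact hv
    by_contra hvX
    rcases hv' with hvB | ⟨w, hw, hvw⟩
    · exact hno a ha v hvB haX hav
    · exact hw (Or.inr ⟨a, ha, haX, hav.tail ⟨hvw, hvX, fun hwX => hw (Or.inl hwX)⟩⟩)
  have h3 := Set.ncard_le_ncard h2
  rw [Set.ncard_coe_finset] at h3
  omega

/-- Menger's theorem for vertex-disjoint paths in directed graphs. -/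
theorem exists_isLinkage [Finite V] {r : V → V → Prop} {A B : Finset V}
    (h : ∀ X : Finset V, X.card < A.card →
      ∃ a ∈ A, ∃ b ∈ B, a ∉ X ∧ ReachIn r (X : Set V)ᶜ a b) :
    ∃ S e, IsLinkage r A B S e := by
  classical
  -- In a minimal subrelation every vertex has at most one out-arc and vertices of `B` have none.
  -- The forward orbits of the vertices of `A` are then the desired paths.
  obtain ⟨m, hmr, hm⟩ := exists_minimal_le_of_wellFoundedLT
    (fun m : V → V → Prop => ∀ R : Set V, (A : Set V) ⊆ R → A.card ≤ (boundary m B R).ncard) r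
    (le_boundary_of_reach h)
  have hfun := rightUnique_of_minimal_boundary hm
  have hB : ∀ b ∈ B, ∀ y, ¬ m b y := by
    intro b hb y hby
    obtain ⟨R, -, -, -, hbB, -⟩ := boundary_critical hm hby
    exact hbB hb
  have hreach := reach_of_le_boundary hm.1
  have hlift : ∀ {X : Set V} {u v : V}, ReachIn m X u v → ReflTransGen m u v :=
    fun huv => ReflTransGen.mono (fun _ _ hab => hab.1) _ _ huv
  have hBend : ∀ {b v}, b ∈ B → ReflTransGen m b v → v = b := fun hb hbv => by
    rcases hbv.cases_head with rfl | ⟨c, hc, -⟩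
    · rfl
    · exact absurd hc (hB _ hb c)
  have hend : ∀ a, ∃ b, a ∈ A → b ∈ B ∧ ReflTransGen m a b := by
    intro a
    by_cases ha : a ∈ A
    · obtain ⟨a', ha', b, hb, hX, hab⟩ := hreach (A.erase a) (Finset.card_erase_lt_of_mem ha)
      obtain rfl : a' = a := by
        by_contra hne
        exact hX (Finset.mem_erase.2 ⟨hne, ha'⟩)
      exact ⟨b, fun _ => ⟨hb, hlift hab⟩⟩
    · exact ⟨a, fun h => absurd h ha⟩
  choose e he using hend
  have hin : ∀ {a u v : V}, ReflTransGen m a u → ReflTransGen m u v →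
      ReachIn r {x | ReflTransGen m a x} u v := by
    intro a u v hau huv
    induction huv with
    | refl => exact ReachIn.refl _
    | tail huc hcd ih => exact ih.tail ⟨hmr _ _ hcd, hau.trans huc, (hau.trans huc).tail hcd⟩
  refine ⟨fun a => {x | ReflTransGen m a x}, e, ⟨fun a _ => ReflTransGen.refl,
    fun a ha => (he a ha).2, fun a ha => (he a ha).1, fun a _ v hv => hin ReflTransGen.refl hv,
    fun a ha v hv => hin hv ?_, ?_⟩⟩
  · rcases ReflTransGen.total_of_right_unique hfun hv (he a ha).2 with h' | h'
    · exact h'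
    · rw [hBend (he a ha).1 h']
  · intro a ha a' ha' hne
    rw [Set.disjoint_left]
    intro v hv hv'
    -- If the orbits of `a` and `a'` meet at `v`, deleting `v` and the rest of `A` should still
    -- leave a walk to `B`. That walk starts on an orbit leading to `v` and cannot pass `v`, so its
    -- end `b` still leads to `v`; as `b` has no out-arc, `b = v`, which was deleted.
    have hcard : (insert v ((A.erase a).erase a')).card < A.card := by
      refine lt_of_le_of_lt (Finset.card_insert_le _ _) ?_
      have h1 := Finset.card_erase_add_one ha
      have h2 := Finset.card_erase_add_one (Finset.mem_erase.2 ⟨Ne.symm hne, ha'⟩)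
      omega
    obtain ⟨c, hc, b, hb, hcX, hcb⟩ := hreach _ hcard
    have hcv : ReflTransGen m c v := by
      by_contra hcv
      refine hcX (Finset.mem_insert_of_mem (Finset.mem_erase.2 ⟨?_, Finset.mem_erase.2 ⟨?_, hc⟩⟩))
      · rintro rfl; exact hcv hv'
      · rintro rfl; exact hcv hv
    have hbX := hcb.mem fun h => hcX h
    have hbv : ReflTransGen m b v := by
      clear hcX hc
      induction hcb using ReflTransGen.head_induction_on with
      | refl => exact hcv
      | head hcd hdb ih =>
        rcases hcv.cases_head with rfl | ⟨d', hd', hdv⟩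
        · exact absurd (Finset.mem_insert_self _ _) hcd.2.1
        · exact ih (hfun hcd.1 hd' ▸ hdv)
    exact hbX (by simp [hBend hb hbv])

/-! ### Sets linked to and from a haven -/

theorem IsHaven.flip {r : V → V → Prop} {w : ℕ} {β : Finset V → Set V} (h : IsHaven r w β) :
    IsHaven (fun a b => r b a) w β :=
  ⟨h.nonempty, h.notMem, h.anti, fun X hX u hu v hv => (h.reach X hX v hv u hu).flip⟩

/-- No set smaller than `A` separates `A` from the haven. -/
def IsLinkedTo (r : V → V → Prop) (β : Finset V → Set V) (A : Finset V) : Prop :=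
  ∀ X : Finset V, X.card < A.card → ∃ a ∈ A, ∃ v ∈ β X, a ∉ X ∧ ReachIn r (X : Set V)ᶜ a v

/-- The haven cannot be kept away from `Q` by deleting fewer than `c` vertices. -/
def HasOrder (β : Finset V → Set V) (c : ℕ) (Q : Set V) : Prop :=
  ∀ X : Finset V, X.card < c → ∃ v ∈ β X, v ∈ Q

theorem ncard_boundary_union_add_inter [Finite V] (r : V → V → Prop) (R₁ R₂ : Set V) :
    (boundary r ∅ (R₁ ∪ R₂)).ncard + (boundary r ∅ (R₁ ∩ R₂)).ncard ≤
      (boundary r ∅ R₁).ncard + (boundary r ∅ R₂).ncard := by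
  classical
  have e1 : boundary r ∅ (R₁ ∪ R₂) ∪ boundary r ∅ (R₁ ∩ R₂) ⊆
      boundary r ∅ R₁ ∪ boundary r ∅ R₂ := by
    rintro v (⟨hv, hv' | ⟨w, hw, hvw⟩⟩ | ⟨⟨hv1, hv2⟩, hv' | ⟨w, hw, hvw⟩⟩)
    · exact hv'.elim
    · rcases hv with hv | hv
      · exact Or.inl ⟨hv, Or.inr ⟨w, fun h => hw (Or.inl h), hvw⟩⟩
      · exact Or.inr ⟨hv, Or.inr ⟨w, fun h => hw (Or.inr h), hvw⟩⟩
    · exact hv'.elim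
    · by_cases hwR : w ∈ R₁
      · exact Or.inr ⟨hv2, Or.inr ⟨w, fun h => hw ⟨hwR, h⟩, hvw⟩⟩
      · exact Or.inl ⟨hv1, Or.inr ⟨w, hwR, hvw⟩⟩
  have e2 : boundary r ∅ (R₁ ∪ R₂) ∩ boundary r ∅ (R₁ ∩ R₂) ⊆
      boundary r ∅ R₁ ∩ boundary r ∅ R₂ := by
    rintro v ⟨⟨-, hv' | ⟨w, hw, hvw⟩⟩, ⟨⟨hv1, hv2⟩, -⟩⟩
    · exact hv'.elim
    · exact ⟨⟨hv1, Or.inr ⟨w, fun h => hw (Or.inl h), hvw⟩⟩,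
        ⟨hv2, Or.inr ⟨w, fun h => hw (Or.inr h), hvw⟩⟩⟩
  have c1 := Set.ncard_le_ncard e1
  have c2 := Set.ncard_le_ncard e2
  have c3 := Set.ncard_union_add_ncard_inter (boundary r ∅ (R₁ ∪ R₂)) (boundary r ∅ (R₁ ∩ R₂))
  have c4 := Set.ncard_union_add_ncard_inter (boundary r ∅ R₁) (boundary r ∅ R₂)
  omega

/-- The sets `β D` and `β Y` share a vertex of `β (D ∪ Y)`, which lies outside `R`. A walk inside `β
D` avoids `D` and so cannot leave `R`; thus no vertex of `β D` is in `R`. -/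
theorem IsHaven.notMem_of_boundary_subset {r : V → V → Prop} {w : ℕ} {β : Finset V → Set V}
    (h : IsHaven r w β) {R : Set V} {D Y : Finset V} (hY : ∀ v ∈ β Y, v ∉ R)
    (hD : boundary r ∅ R ⊆ D) (hcard : D.card + Y.card ≤ w) : ∀ v ∈ β D, v ∉ R := by
  classical
  intro v hv hvR
  obtain ⟨x, hx⟩ := h.nonempty (D ∪ Y) ((Finset.card_union_le _ _).trans hcard)
  refine hY x (h.anti _ _ Finset.subset_union_right hx) ?_
  refine (h.reach D (by omega) v hv x (h.anti _ _ Finset.subset_union_left hx)).mem_of_closed hvR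
    fun a b hab ha _ haR => ?_
  by_contra hbR
  exact h.notMem D a ha (hD ⟨haR, Or.inr ⟨b, hbR, hab⟩⟩)

/-- Since `A` is linked to the haven, the boundary of `R₁ ∩ R₂` has at least `A.card` vertices;
submodularity then leaves at most `A.card` for the union. The order `3 * A.card` allows for deleting
`D`, `D₁` and `D₂` together. -/
theorem IsHaven.exists_boundary_union [Finite V] {r : V → V → Prop} {w : ℕ}
    {β : Finset V → Set V} (h : IsHaven r w β) {A : Finset V} (hA : IsLinkedTo r β A)
    (hw : 3 * A.card ≤ w) {R₁ R₂ : Set V} {D₁ D₂ : Finset V} (hAR₁ : (A : Set V) ⊆ R₁)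
    (hAR₂ : (A : Set V) ⊆ R₂) (hD₁ : boundary r ∅ R₁ ⊆ D₁) (hD₂ : boundary r ∅ R₂ ⊆ D₂)
    (hc₁ : D₁.card ≤ A.card) (hc₂ : D₂.card ≤ A.card) (hβ₁ : ∀ v ∈ β D₁, v ∉ R₁)
    (hβ₂ : ∀ v ∈ β D₂, v ∉ R₂) :
    ∃ D : Finset V, boundary r ∅ (R₁ ∪ R₂) ⊆ D ∧ D.card ≤ A.card ∧ ∀ v ∈ β D, v ∉ R₁ ∪ R₂ := by
  classical
  have hsub := ncard_boundary_union_add_inter r R₁ R₂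
  have hn₁ := Set.ncard_le_ncard hD₁
  have hn₂ := Set.ncard_le_ncard hD₂
  rw [Set.ncard_coe_finset] at hn₁ hn₂
  set D := (Set.toFinite (boundary r ∅ (R₁ ∪ R₂))).toFinset with hD
  set D' := (Set.toFinite (boundary r ∅ (R₁ ∩ R₂))).toFinset with hD'
  rw [Set.ncard_eq_toFinset_card _ (Set.toFinite (boundary r ∅ (R₁ ∪ R₂))),
    Set.ncard_eq_toFinset_card _ (Set.toFinite (boundary r ∅ (R₁ ∩ R₂)))] at hsub
  change D.card + D'.card ≤ _ at hsub
  have hDc : (D : Set V) = boundary r ∅ (R₁ ∪ R₂) := by simp [hD]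
  have hDc' : (D' : Set V) = boundary r ∅ (R₁ ∩ R₂) := by simp [hD']
  have hinter : A.card ≤ D'.card := by
    by_contra! hlt
    obtain ⟨a, ha, v, hv, haD, hav⟩ := hA D' hlt
    refine h.notMem_of_boundary_subset (R := R₁ ∩ R₂) (Y := D₁) (fun x hx hxR => hβ₁ x hx hxR.1)
      hDc'.ge (by omega) v hv ?_
    refine hav.mem_of_closed ⟨hAR₁ ha, hAR₂ ha⟩ fun x y hxy hx _ hxR => ?_
    by_contra hyR
    refine hx ?_
    rw [hDc']
    exact ⟨hxR, Or.inr ⟨y, hyR, hxy⟩⟩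
  have hDcard : D.card ≤ A.card := by omega
  refine ⟨D, hDc.ge, hDcard, ?_⟩
  refine h.notMem_of_boundary_subset (Y := D₁ ∪ D₂) ?_ hDc.ge ?_
  · rintro x hx (hxR | hxR)
    · exact hβ₁ x (h.anti _ _ Finset.subset_union_left hx) hxR
    · exact hβ₂ x (h.anti _ _ Finset.subset_union_right hx) hxR
  · have := Finset.card_union_le D₁ D₂
    omega

/-- Take for `R` the set `X` together with all vertices that cannot reach `β X` off `X`. -/
theorem IsHaven.exists_boundary_of_separated {r : V → V → Prop} {w : ℕ} {β : Finset V → Set V}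
    (h : IsHaven r w β) (X : Finset V) : ∃ R : Set V, boundary r ∅ R ⊆ X ∧ (∀ v ∈ β X, v ∉ R) ∧
      ∀ a, (∀ v ∈ β X, a ∉ X → ¬ ReachIn r (X : Set V)ᶜ a v) → a ∈ R := by
  refine ⟨{a | ∀ v ∈ β X, a ∉ X → ¬ ReachIn r (X : Set V)ᶜ a v}, ?_, ?_, fun a ha => ha⟩
  · rintro a ⟨ha, h' | ⟨b, hb, hab⟩⟩
    · exact h'.elim
    by_contra haX
    refine hb fun v hv hbX hbv => ha v hv haX (ReflTransGen.head ⟨hab, haX, hbX⟩ hbv)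
  · intro v hv hvR
    exact hvR v hv (h.notMem X v hv) (ReachIn.refl _)

/-- Vertices that cannot enlarge a linked set are jointly separated from the haven by few
vertices. -/
theorem IsHaven.exists_boundary_closure [Finite V] [DecidableEq V] {r : V → V → Prop} {w : ℕ}
    {β : Finset V → Set V} (h : IsHaven r w β) {A : Finset V} (hA : IsLinkedTo r β A)
    (hw : 3 * A.card ≤ w) (U : Finset V)
    (hU : ∀ q ∈ U, q ∉ A → ¬ IsLinkedTo r β (insert q A)) :
    ∃ (R : Set V) (D : Finset V), (A : Set V) ⊆ R ∧ (U : Set V) ⊆ R ∧ boundary r ∅ R ⊆ D ∧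
      D.card ≤ A.card ∧ ∀ v ∈ β D, v ∉ R := by
  induction U using Finset.induction_on with
  | empty =>
    obtain ⟨R, hR, hβ, hsep⟩ := h.exists_boundary_of_separated A
    exact ⟨R, A, fun a ha => hsep a fun v _ haA => absurd ha haA, by simp, hR, le_rfl, hβ⟩
  | insert q U _ ih =>
    obtain ⟨R₁, D₁, hA₁, hU₁, hD₁, hc₁, hβ₁⟩ :=
      ih fun x hx => hU x (Finset.mem_insert_of_mem hx)
    by_cases hq : q ∈ A
    · refine ⟨R₁, D₁, hA₁, ?_, hD₁, hc₁, hβ₁⟩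
      rw [Finset.coe_insert]
      exact Set.insert_subset (hA₁ hq) hU₁
    · have hnot := hU q (Finset.mem_insert_self _ _) hq
      unfold IsLinkedTo at hnot
      push Not at hnot
      obtain ⟨X, hX, hXsep⟩ := hnot
      rw [Finset.card_insert_of_notMem hq] at hX
      obtain ⟨R₂, hD₂, hβ₂, hsep⟩ := h.exists_boundary_of_separated X
      have hin : ∀ a ∈ insert q A, a ∈ R₂ := fun a ha => hsep a (hXsep a ha)
      have hA₂ : (A : Set V) ⊆ R₂ := fun a ha => hin a (Finset.mem_insert_of_mem ha)
      obtain ⟨D, hD, hc, hβ⟩ := h.exists_boundary_union hA hw hA₁ hA₂ hD₁ hD₂ hc₁ (by omega)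
        hβ₁ hβ₂
      refine ⟨R₁ ∪ R₂, D, hA₁.trans Set.subset_union_left, ?_, hD, hc, hβ⟩
      rw [Finset.coe_insert]
      exact Set.insert_subset (Or.inr (hin q (Finset.mem_insert_self _ _)))
        (hU₁.trans Set.subset_union_left)

/-- A set of large order contains a large set linked to and from the haven. -/
theorem IsHaven.exists_isLinkedTo [Finite V] {r : V → V → Prop} {w : ℕ} {β : Finset V → Set V}
    (h : IsHaven r w β) {c : ℕ} {Q : Finset V} (hQ : HasOrder β c Q) {n : ℕ} (hn : 2 * n ≤ c)
    (hw : 3 * n ≤ w) : ∃ A ⊆ Q, A.card = n ∧ IsLinkedTo r β A ∧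
      IsLinkedTo (fun a b => r b a) β A := by
  classical
  induction n with
  | zero => exact ⟨∅, by simp, rfl, fun X hX => by simp at hX, fun X hX => by simp at hX⟩
  | succ n ih =>
    obtain ⟨A, hAQ, hAn, hout, hin⟩ := ih (by omega) (by omega)
    suffices ∃ q ∈ Q, q ∉ A ∧ IsLinkedTo r β (insert q A) ∧
        IsLinkedTo (fun a b => r b a) β (insert q A) by
      obtain ⟨q, hqQ, hqA, h1, h2⟩ := this
      exact ⟨insert q A, Finset.insert_subset hqQ hAQ, by
        rw [Finset.card_insert_of_notMem hqA, hAn], h1, h2⟩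
    by_contra! hno
    obtain ⟨R₁, D₁, hA₁, hU₁, -, hc₁, hβ₁⟩ := h.exists_boundary_closure hout (by omega)
      (Q.filter fun q => ¬ IsLinkedTo r β (insert q A)) fun q hq _ => (Finset.mem_filter.1 hq).2
    obtain ⟨R₂, D₂, -, hU₂, -, hc₂, hβ₂⟩ := h.flip.exists_boundary_closure hin (by omega)
      (Q.filter fun q => ¬ IsLinkedTo (fun a b => r b a) β (insert q A))
      fun q hq _ => (Finset.mem_filter.1 hq).2
    -- If no vertex of `Q` enlarges `A` in both directions, `Q` is covered by two closures with at
    -- most `n` boundary vertices each. Deleting these at most `2 * n < c` vertices keeps the haven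
    -- outside both closures, yet it still meets `Q`.
    have hcard := Finset.card_union_le D₁ D₂
    obtain ⟨v, hv, hvQ⟩ := hQ (D₁ ∪ D₂) (by omega)
    have hv₁ := hβ₁ v (h.anti _ _ Finset.subset_union_left hv)
    have hv₂ := hβ₂ v (h.anti _ _ Finset.subset_union_right hv)
    have hvA : v ∉ A := fun hvA => hv₁ (hA₁ hvA)
    have hl₁ : IsLinkedTo r β (insert v A) := by
      by_contra hl
      exact hv₁ (hU₁ (Finset.mem_coe.2 (Finset.mem_filter.2 ⟨hvQ, hl⟩)))
    exact hv₂ (hU₂ (Finset.mem_coe.2 (Finset.mem_filter.2 ⟨hvQ, hno v hvQ hvA hl₁⟩)))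

/-- A set linked to the haven can be linked to an equally large set linked from it. -/
theorem IsHaven.exists_isLinkage [Finite V] {r : V → V → Prop} {w : ℕ} {β : Finset V → Set V}
    (h : IsHaven r w β) {A B : Finset V} (hA : IsLinkedTo r β A)
    (hB : IsLinkedTo (fun a b => r b a) β B) (hAB : A.card = B.card) (hw : A.card ≤ w) :
    ∃ S e, IsLinkage r A B S e := by
  refine Digraph.exists_isLinkage fun X hX => ?_
  obtain ⟨a, ha, v, hv, haX, hav⟩ := hA X hX
  obtain ⟨b, hb, u, hu, -, hbu⟩ := hB X (hAB ▸ hX)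
  refine ⟨a, ha, b, hb, haX, (hav.trans ?_).trans hbu.flip⟩
  exact (h.reach X (by omega) v hv u hu).mono fun x hx => h.notMem X x hx

/-! ### A path met by the haven, and its pieces -/

theorem HasOrder.mono {β : Finset V → Set V} {c d : ℕ} {Q R : Set V} (h : HasOrder β d Q)
    (hcd : c ≤ d) (hQR : Q ⊆ R) : HasOrder β c R := fun X hX => by
  obtain ⟨v, hv, hvQ⟩ := h X (by omega)
  exact ⟨v, hv, hQR hvQ⟩

/-- The path must end at `v` but need only contain `u`. So when a walk is extended backwards to a
vertex already on the path, the path can be kept unchanged. -/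
theorem ReachIn.exists_nodup_list {r : V → V → Prop} {S : Set V} {u v : V} (h : ReachIn r S u v)
    (hv : v ∈ S) : ∃ l : List V, List.IsChain r (l ++ [v]) ∧ (l ++ [v]).Nodup ∧
      (∀ x ∈ l ++ [v], x ∈ S) ∧ u ∈ l ++ [v] := by
  classical
  induction h using ReflTransGen.head_induction_on with
  | refl => exact ⟨[], by simp, by simp, by simpa using hv, by simp⟩
  | @head a b hab _ ih =>
    obtain ⟨l, hl, hnd, hS, hb⟩ := ih
    by_cases ha : a ∈ l ++ [v]
    · exact ⟨l, hl, hnd, hS, ha⟩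
    obtain ⟨s, t, hst⟩ := List.append_of_mem hb
    have hsuf : (b :: t) <:+ (l ++ [v]) := ⟨s, hst.symm⟩
    have hlast : ∃ t', b :: t = t' ++ [v] := by
      have h1 := List.dropLast_append_getLast (List.cons_ne_nil b t)
      have h2 : (b :: t).getLast (List.cons_ne_nil b t) = v := by
        rw [hsuf.getLast]
        simp
      exact ⟨_, by rw [← h1, h2]⟩
    obtain ⟨t', ht'⟩ := hlast
    refine ⟨a :: t', ?_, ?_, ?_, by simp⟩
    · rw [List.cons_append, ← ht', List.isChain_cons_cons]
      exact ⟨hab.1, hl.suffix hsuf⟩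
    · rw [List.cons_append, ← ht', List.nodup_cons]
      exact ⟨fun h => ha (hsuf.subset h), hnd.sublist hsuf.sublist⟩
    · rw [List.cons_append, ← ht']
      intro x hx
      rcases List.mem_cons.1 hx with rfl | hx
      · exact hab.2.1
      · exact hS x (hsuf.subset hx)

theorem exists_last_mem (T : Set V) : ∀ l : List V, (∃ x ∈ l, x ∈ T) →
    ∃ s u t, l = s ++ u :: t ∧ u ∈ T ∧ ∀ x ∈ t, x ∉ T
  | [], h => by simp at h
  | a :: l, h => by
    by_cases hl : ∃ x ∈ l, x ∈ T
    · obtain ⟨s, u, t, rfl, hu, ht⟩ := exists_last_mem T l hl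
      exact ⟨a :: s, u, t, rfl, hu, ht⟩
    · push Not at hl
      obtain ⟨x, hx, hxT⟩ := h
      rcases List.mem_cons.1 hx with rfl | hx
      · exact ⟨[], x, l, rfl, hxT, hl⟩
      · exact absurd hxT (hl x hx)

/-- Some path meets every set to which the haven points after few deletions. -/
theorem IsHaven.exists_path [Finite V] {r : V → V → Prop} {w n : ℕ} {β : Finset V → Set V}
    (h : IsHaven r w β) (hn : 2 * n ≤ w) :
    ∃ l : List V, List.IsChain r l ∧ l.Nodup ∧ HasOrder β n {v | v ∈ l} := by
  classical
  rcases Nat.eq_zero_or_pos n with rfl | hn0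
  · exact ⟨[], by simp, by simp, fun X hX => by simp at hX⟩
  by_contra! hno
  -- The path is grown backwards so that only its first vertex lies in the current `β X`. If `β Y`
  -- misses the whole path, a path inside `β X` from `β Y` to `v`, cut at its last vertex in `β Y`,
  -- is prepended and `Y` replaces `X`. Being inside `β X`, the new part meets the old path only in
  -- `v`.
  have grow : ∀ k : ℕ, ∃ (v : V) (l : List V) (X : Finset V), X.card < n ∧ k ≤ l.length ∧
      List.IsChain r (v :: l) ∧ (v :: l).Nodup ∧ v ∈ β X ∧ ∀ x ∈ l, x ∉ β X := by
    intro k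
    induction k with
    | zero =>
      obtain ⟨v, hv⟩ := h.nonempty ∅ (by simp)
      exact ⟨v, [], ∅, by simpa using hn0, by simp, by simp, by simp, hv, by simp⟩
    | succ k ih =>
      obtain ⟨v, l, X, hX, hk, hl, hnd, hv, hlX⟩ := ih
      have := hno _ hl hnd
      unfold HasOrder at this
      push Not at this
      obtain ⟨Y, hY, hYl⟩ := this
      have hYl' : ∀ x ∈ v :: l, x ∉ β Y := fun x hx hxY => hYl x hxY hx
      obtain ⟨u, hu⟩ := h.nonempty (X ∪ Y) ((Finset.card_union_le _ _).trans (by omega))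
      have huX := h.anti _ _ Finset.subset_union_left hu
      have huY := h.anti _ _ Finset.subset_union_right hu
      obtain ⟨m, hm, hmnd, hmX, hum⟩ :=
        (h.reach X (by omega) u huX v hv).exists_nodup_list hv
      obtain ⟨s, u', t, hst, hu', ht⟩ := exists_last_mem (β Y) (m ++ [v]) ⟨u, hum, huY⟩
      have hsuf : (u' :: t) <:+ (m ++ [v]) := ⟨s, hst.symm⟩
      have hvu' : u' ≠ v := by
        rintro rfl
        exact hYl' _ (by simp) hu'
      have ht0 : t ≠ [] := by
        rintro rfl
        have h2 : u' = v := by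
          have := hsuf.getLast (by simp)
          simpa using this
        exact hvu' h2
      have htl : ∃ t', t = t' ++ [v] := by
        have h1 := List.dropLast_append_getLast ht0
        have h2 : t.getLast ht0 = v := by
          have := hsuf.getLast (by simp)
          rw [List.getLast_cons ht0] at this
          simpa using this
        exact ⟨t.dropLast, by rw [← h2, h1]⟩
      obtain ⟨t', rfl⟩ := htl
      refine ⟨u', t' ++ v :: l, Y, hY, by simp; omega, ?_, ?_, hu', ?_⟩
      · rw [← List.cons_append, List.isChain_split]
        exact ⟨hm.suffix hsuf, hl⟩
      · have hsnd := hmnd.sublist hsuf.sublist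
        have h3 : u' :: (t' ++ v :: l) = (u' :: (t' ++ [v])) ++ l := by simp
        rw [h3, List.nodup_append]
        refine ⟨hsnd, (List.nodup_cons.1 hnd).2, ?_⟩
        rintro a ha b hb rfl
        exact hlX a hb (hmX a (hsuf.subset ha))
      · intro x hx
        rcases List.mem_append.1 hx with hx | hx
        · exact ht x (by simp [hx])
        · exact hYl' x hx
  have := Fintype.ofFinite V
  obtain ⟨v, l, X, -, hk, -, hnd, -⟩ := grow (Fintype.card V)
  have := hnd.length_le_card
  simp at this
  omega

/-- Cut after the shortest prefix of order `c`. If the prefix is nonempty, the prefix one vertex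
shorter is missed after deleting some `X` with at most `c - 1` vertices. Deleting `X`, the last
vertex of the prefix and at most `d - 1` more vertices stays below `c + d`, so the haven must meet
the remaining suffix. -/
theorem HasOrder.exists_split {β : Finset V → Set V}
    (hanti : ∀ X Y : Finset V, X ⊆ Y → β Y ⊆ β X) (hnot : ∀ X : Finset V, ∀ v ∈ β X, v ∉ X)
    {l : List V} {c d : ℕ} (h : HasOrder β (c + d) {v | v ∈ l}) :
    ∃ l₁ l₂, l = l₁ ++ l₂ ∧ HasOrder β c {v | v ∈ l₁} ∧ HasOrder β d {v | v ∈ l₂} := by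
  classical
  have hex : ∃ n, HasOrder β c {v | v ∈ l.take n} :=
    ⟨l.length, by rw [List.take_length]; exact h.mono (by omega) le_rfl⟩
  refine ⟨l.take (Nat.find hex), l.drop (Nat.find hex), (List.take_append_drop _ _).symm,
    Nat.find_spec hex, fun Y hY => ?_⟩
  obtain hzero | ⟨n, hn⟩ := Nat.eq_zero_or_eq_succ_pred (Nat.find hex) |>.imp id
    fun h => (⟨_, h⟩ : ∃ n, Nat.find hex = n + 1)
  · rw [hzero, List.drop_zero]
    exact h Y (by omega)
  have hlt := Nat.find_min hex (m := n) (by omega)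
  unfold HasOrder at hlt
  push Not at hlt
  obtain ⟨X, hX, hXl⟩ := hlt
  have hcard : (X ∪ (l[n]?.toList.toFinset ∪ Y)).card < c + d := by
    have h1 := Finset.card_union_le X (l[n]?.toList.toFinset ∪ Y)
    have h2 := Finset.card_union_le l[n]?.toList.toFinset Y
    have h3 : (l[n]?.toList.toFinset).card ≤ 1 := by
      cases l[n]? <;> simp
    omega
  obtain ⟨v, hv, hvl⟩ := h _ hcard
  refine ⟨v, hanti _ _ (Finset.subset_union_right.trans Finset.subset_union_right) hv, ?_⟩
  have hvX := hXl v (hanti _ _ Finset.subset_union_left hv)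
  have hvn := hnot _ v hv
  rw [hn]
  change v ∈ l at hvl
  rw [← List.take_append_drop (n + 1) l, List.mem_append, List.take_add_one,
    List.mem_append] at hvl
  rcases hvl with (hvl | hvl) | hvl
  · exact absurd hvl hvX
  · exact absurd (by simp [List.mem_toFinset, hvl]) hvn
  · exact hvl

theorem reachIn_of_isChain_append {r : V → V → Prop} {l₁ l₂ : List V}
    (h : List.IsChain r (l₁ ++ l₂)) {a b : V} (ha : a ∈ l₁) (hb : b ∈ l₂) :
    ReachIn r {v | v ∈ l₁ ++ l₂} a b := by
  have h1 : List.IsChain (ReachIn r {v | v ∈ l₁ ++ l₂}) (l₁ ++ l₂) :=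
    h.imp_of_mem_imp fun x y hx hy hxy => ReflTransGen.single ⟨hxy, hx, hy⟩
  have : IsTrans V (ReachIn r {v | v ∈ l₁ ++ l₂}) := ⟨fun _ _ _ => ReachIn.trans⟩
  rw [List.isChain_iff_pairwise, List.pairwise_append] at h1
  exact h1.2.2 a ha b hb

/-- Within a piece all of `Q t` precedes all of `Q' t` on the path. A linkage path from `Q' t` back
to `Q t` will therefore close a cycle. -/
theorem exists_pieces {r : V → V → Prop} {β : Finset V → Set V}
    (hanti : ∀ X Y : Finset V, X ⊆ Y → β Y ⊆ β X) (hnot : ∀ X : Finset V, ∀ v ∈ β X, v ∉ X)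
    (c m : ℕ) (l : List V) (hl : List.IsChain r l) (hnd : l.Nodup)
    (h : HasOrder β (m * (c + c)) {v | v ∈ l}) :
    ∃ Q Q' : ℕ → Finset V,
      (∀ t < m, HasOrder β c (Q t) ∧ HasOrder β c (Q' t) ∧
        (∀ a ∈ Q t, ∀ b ∈ Q' t, a ≠ b ∧ ReachIn r (Q t ∪ Q' t : Set V) a b) ∧
        ∀ a, a ∈ Q t ∨ a ∈ Q' t → a ∈ l) ∧
      ∀ s < m, ∀ t < m, s ≠ t → Disjoint (Q s ∪ Q' s : Set V) (Q t ∪ Q' t : Set V) := by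
  classical
  induction m generalizing l with
  | zero => exact ⟨fun _ => ∅, fun _ => ∅, by simp, by simp⟩
  | succ m ih =>
    rw [Nat.succ_mul, Nat.add_comm] at h
    obtain ⟨l₁₂, l₃, rfl, h₁₂, h₃⟩ := h.exists_split hanti hnot
    obtain ⟨l₁, l₂, rfl, h₁, h₂⟩ := h₁₂.exists_split hanti hnot
    rw [List.nodup_append] at hnd
    obtain ⟨Q, Q', hQ, hdisj⟩ := ih l₃ hl.right_of_append hnd.2.1 h₃
    refine ⟨fun t => Nat.casesOn t l₁.toFinset Q, fun t => Nat.casesOn t l₂.toFinset Q', ?_, ?_⟩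
    · rintro (_ | t) ht
      · refine ⟨by simpa using h₁, by simpa using h₂, fun a ha b hb => ?_, fun a ha => ?_⟩
        · replace ha : a ∈ l₁ := List.mem_toFinset.1 ha
          replace hb : b ∈ l₂ := List.mem_toFinset.1 hb
          refine ⟨(List.nodup_append.1 hnd.1).2.2 a ha b hb,
            (reachIn_of_isChain_append hl.left_of_append ha hb).mono ?_⟩
          intro x hx
          simpa using hx
        · exact List.mem_append_left _
            (List.mem_append.2 (ha.imp List.mem_toFinset.1 List.mem_toFinset.1))
      · obtain ⟨q1, q2, q3, q4⟩ := hQ t (by omega)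
        exact ⟨q1, q2, q3, fun a ha => List.mem_append_right _ (q4 a ha)⟩
    · have hcross : ∀ t < m, Disjoint ((l₁.toFinset : Set V) ∪ l₂.toFinset) (Q t ∪ Q' t) := by
        intro t ht
        rw [Set.disjoint_left]
        intro x hx hx'
        refine hnd.2.2 x ?_ x ((hQ t ht).2.2.2 x hx') rfl
        simpa using hx
      rintro (_ | s) hs (_ | t) ht hst
      · exact absurd rfl hst
      · exact hcross t (by omega)
      · exact (hcross s (by omega)).symm
      · exact hdisj s (by omega) t (by omega) (by omega)

/-! ### Decreasing pairs in dense subsets of the grid -/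

/-- A finite set of points of the grid without a strictly decreasing pair is small. -/
theorem card_le_of_no_decreasing {A B : Finset ℕ} {E : Finset (ℕ × ℕ)} (hE : E ⊆ A ×ˢ B)
    (h : ∀ a b c d, a < b → c < d → (a, d) ∈ E → (b, c) ∉ E) : E.card ≤ A.card + B.card := by
  classical
  have hA : ∀ x ∈ E, x.1 ∈ A := fun x hx => (Finset.mem_product.1 (hE hx)).1
  have hB : ∀ x ∈ E, x.2 ∈ B := fun x hx => (Finset.mem_product.1 (hE hx)).2
  -- The lowest points of the columns are determined by their column. The others are determined by
  -- their row: of two in one row, the right one has a point below it, which forms a decreasing pair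
  -- with the left one.
  rw [← Finset.card_filter_add_card_filter_not (fun x : ℕ × ℕ => ∀ y ∈ E, y.1 = x.1 → x.2 ≤ y.2)]
  refine Nat.add_le_add (Finset.card_le_card_of_injOn Prod.fst ?_ ?_)
    (Finset.card_le_card_of_injOn Prod.snd ?_ ?_)
  · intro x hx
    exact hA x (Finset.mem_filter.1 hx).1
  · intro x hx y hy hxy
    have hx' := Finset.mem_filter.1 hx
    have hy' := Finset.mem_filter.1 hy
    exact Prod.ext hxy (le_antisymm (hx'.2 y hy'.1 hxy.symm) (hy'.2 x hx'.1 hxy))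
  · intro x hx
    exact hB x (Finset.mem_filter.1 hx).1
  · have key : ∀ x ∈ E, ∀ y ∈ E, (∃ z ∈ E, z.1 = y.1 ∧ z.2 < y.2) → x.2 = y.2 → ¬ x.1 < y.1 := by
      rintro ⟨a, d⟩ hx ⟨b, d'⟩ hy ⟨⟨b', c⟩, hz, hz1, hz2⟩ hd hlt
      simp only at hz1 hz2 hd hlt
      subst hz1 hd
      exact h a b' c d hlt hz2 hx hz
    intro x hx y hy hxy
    have hx' := Finset.mem_filter.1 hx
    have hy' := Finset.mem_filter.1 hy
    push Not at hx' hy'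
    have h1 := key x hx'.1 y hy'.1 hy'.2 hxy
    have h2 := key y hy'.1 x hx'.1 hx'.2 hxy.symm
    exact Prod.ext (by omega) hxy

theorem sum_card_filter_eq_le {α : Type*} (D : Finset α) (h : α → ℕ) (N : ℕ) :
    ∑ p ∈ Finset.range N, (D.filter fun i => h i = p).card ≤ D.card := by
  classical
  rw [← Finset.card_biUnion]
  · refine Finset.card_le_card fun i hi => ?_
    obtain ⟨p, -, hp⟩ := Finset.mem_biUnion.1 hi
    exact (Finset.mem_filter.1 hp).1
  · intro p _ q _ hpq
    rw [Function.onFun, Finset.disjoint_left]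
    intro i hi hi'
    exact hpq ((Finset.mem_filter.1 hi).2.symm.trans (Finset.mem_filter.1 hi').2)

/-- A finite family of integers with bounded multiplicities splits into `N` intervals of balanced
sizes. -/
theorem exists_balanced_blocks {α : Type*} (E : Finset α) (f : α → ℕ) (N m : ℕ) (hN : 0 < N)
    (hm : ∀ i, (E.filter fun x => f x = i).card ≤ m) :
    ∃ g : ℕ → ℕ, Monotone g ∧ (∀ x ∈ E, g (f x) < N) ∧
      ∀ q, N * (E.filter fun x => g (f x) = q).card ≤ E.card + N * m := by
  classical
  set pre : ℕ → ℕ := fun i => (E.filter fun x => f x < i).card with hpre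
  -- Blocks are cut by rank. Points with equal value stay together, so a block may exceed its share
  -- `E.card / N` by up to `m`.
  refine ⟨fun i => pre i * N / E.card, ?_, ?_, ?_⟩
  · intro i j hij
    refine Nat.div_le_div_right (Nat.mul_le_mul_right _ (Finset.card_le_card ?_))
    exact Finset.monotone_filter_right _ fun x _ hx => lt_of_lt_of_le hx hij
  · intro x hx
    have hlt : pre (f x) < E.card := Finset.card_lt_card (Finset.filter_ssubset.2 ⟨x, hx, by simp⟩)
    rw [Nat.div_lt_iff_lt_mul (by omega), mul_comm]
    exact Nat.mul_lt_mul_of_pos_left hlt hN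
  · intro q
    set S := E.filter fun x => pre (f x) * N / E.card = q with hS
    rcases S.eq_empty_or_nonempty with h0 | hne
    · rw [h0]; simp
    obtain ⟨x₀, hx₀, hmin⟩ := S.exists_min_image f hne
    obtain ⟨x₁, hx₁, hmax⟩ := S.exists_max_image f hne
    have hsub : S ∪ E.filter (fun x => f x < f x₀) ⊆
        E.filter (fun x => f x < f x₁) ∪ E.filter fun x => f x = f x₁ := by
      intro x hx
      rcases Finset.mem_union.1 hx with hx | hx
      · have h1 := hmax x hx
        have h2 := (Finset.mem_filter.1 hx).1
        rw [Finset.mem_union, Finset.mem_filter, Finset.mem_filter]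
        rcases h1.lt_or_eq with h | h
        · exact Or.inl ⟨h2, h⟩
        · exact Or.inr ⟨h2, h⟩
      · have h1 := hmin x₁ hx₁
        rw [Finset.mem_filter] at hx
        exact Finset.mem_union_left _ (Finset.mem_filter.2 ⟨hx.1, by omega⟩)
    have hdis : Disjoint S (E.filter fun x => f x < f x₀) := by
      rw [Finset.disjoint_left]
      intro x hx hx'
      have h1 := hmin x hx
      have h2 := (Finset.mem_filter.1 hx').2
      omega
    have hcard := (Finset.card_le_card hsub).trans (Finset.card_union_le _ _)
    rw [Finset.card_union_of_disjoint hdis] at hcard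
    have hm1 := hm (f x₁)
    have hpos : 0 < E.card := Finset.card_pos.2 ⟨x₀, (Finset.mem_filter.1 hx₀).1⟩
    have e0 := (Finset.mem_filter.1 hx₀).2
    have e1 := (Finset.mem_filter.1 hx₁).2
    have f0 : q * E.card ≤ pre (f x₀) * N := by
      rw [← e0]; exact Nat.div_mul_le_self _ _
    have f1 : pre (f x₁) * N < (q + 1) * E.card := by
      rw [← e1, mul_comm (_ + 1)]; exact Nat.lt_mul_div_succ _ hpos
    have hcard' : S.card + pre (f x₀) ≤ pre (f x₁) + m := by
      simp only [hpre]; omega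
    have := Nat.mul_le_mul_left N hcard'
    nlinarith

/-- A dense set of points of the grid contains many strictly decreasing pairs that are separated in
both coordinates. -/
theorem exists_decreasing_boxes (K : ℕ) {A B : Finset ℕ} {E : Finset (ℕ × ℕ)} (hE : E ⊆ A ×ˢ B)
    (hcard : 10 * K * (A.card + B.card) < E.card) :
    ∃ (T : Finset (ℕ × ℕ)) (a b c d : ℕ × ℕ → ℕ), T.card = K ∧
      (∀ t ∈ T, a t < b t ∧ c t < d t ∧ (a t, d t) ∈ E ∧ (b t, c t) ∈ E) ∧
      ∀ s ∈ T, ∀ t ∈ T, s ≠ t → (b s < a t ∨ b t < a s) ∧ (d s < c t ∨ d t < c s) := by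
  classical
  rcases Nat.eq_zero_or_pos K with rfl | hK
  · exact ⟨∅, fun _ => 0, fun _ => 0, fun _ => 0, fun _ => 0, by simp⟩
  have hA : ∀ x ∈ E, x.1 ∈ A := fun x hx => (Finset.mem_product.1 (hE hx)).1
  have hB : ∀ x ∈ E, x.2 ∈ B := fun x hx => (Finset.mem_product.1 (hE hx)).2
  obtain ⟨g, hg, hgN, hgc⟩ := exists_balanced_blocks E Prod.fst (4 * K) B.card (by omega) fun i =>
    Finset.card_le_card_of_injOn Prod.snd (fun x hx => hB x (Finset.mem_filter.1 hx).1)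
      fun x hx y hy hxy => Prod.ext (((Finset.mem_filter.1 hx).2).trans
        (Finset.mem_filter.1 hy).2.symm) hxy
  obtain ⟨g', hg', hgN', hgc'⟩ := exists_balanced_blocks E Prod.snd (4 * K) A.card (by omega)
    fun i => Finset.card_le_card_of_injOn Prod.fst (fun x hx => hA x (Finset.mem_filter.1 hx).1)
      fun x hx y hy hxy => Prod.ext hxy (((Finset.mem_filter.1 hx).2).trans
        (Finset.mem_filter.1 hy).2.symm)
  set N := 4 * K with hN
  -- A box of the `4 K` by `4 K` subdivision is good if it contains a decreasing pair. Good boxes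
  -- with no common row or column give separated pairs, so a maximum such family `T` is taken.
  let good : ℕ × ℕ → Prop := fun t => ∃ a b c d, a < b ∧ c < d ∧ (a, d) ∈ E ∧ (b, c) ∈ E ∧
    g a = t.1 ∧ g b = t.1 ∧ g' c = t.2 ∧ g' d = t.2
  let ind : Finset (ℕ × ℕ) → Prop := fun T => (∀ t ∈ T, good t) ∧
    ∀ s ∈ T, ∀ t ∈ T, s ≠ t → s.1 ≠ t.1 ∧ s.2 ≠ t.2
  obtain ⟨T, hT, hTmax⟩ := Finset.exists_max_image
    ((Finset.range N ×ˢ Finset.range N).powerset.filter ind) Finset.card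
    ⟨∅, by simp [ind]⟩
  rw [Finset.mem_filter, Finset.mem_powerset] at hT
  obtain ⟨hTN, hTgood, hTind⟩ := hT
  by_cases hTK : K ≤ T.card
  · obtain ⟨T', hT', hTc⟩ := Finset.exists_subset_card_eq hTK
    have hch : ∀ t, ∃ a b c d, t ∈ T → a < b ∧ c < d ∧ (a, d) ∈ E ∧ (b, c) ∈ E ∧
        g a = t.1 ∧ g b = t.1 ∧ g' c = t.2 ∧ g' d = t.2 := by
      intro t
      by_cases ht : t ∈ T
      · obtain ⟨a, b, c, d, h⟩ := hTgood t ht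
        exact ⟨a, b, c, d, fun _ => h⟩
      · exact ⟨0, 0, 0, 0, fun h => absurd h ht⟩
    choose a b c d habcd using hch
    have hsep : ∀ {h : ℕ → ℕ}, Monotone h → ∀ {p q p' q' u u' : ℕ}, h p = u → h q = u → h p' = u' →
        h q' = u' → u ≠ u' → q < p' ∨ q' < p := by
      intro h hh p q p' q' u u' e1 e2 e3 e4 hne
      by_contra! hcon
      have h1 := hh hcon.1
      have h2 := hh hcon.2
      omega
    refine ⟨T', a, b, c, d, hTc, fun t ht => ?_, fun s hs t ht hst => ?_⟩
    · obtain ⟨h1, h2, h3, h4, -⟩ := habcd t (hT' ht)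
      exact ⟨h1, h2, h3, h4⟩
    · obtain ⟨-, -, -, -, s1, s2, s3, s4⟩ := habcd s (hT' hs)
      obtain ⟨-, -, -, -, t1, t2, t3, t4⟩ := habcd t (hT' ht)
      obtain ⟨n1, n2⟩ := hTind s (hT' hs) t (hT' ht) hst
      exact ⟨hsep hg s1 s2 t1 t2 n1, hsep hg' s3 s4 t3 t4 n2⟩
  -- If `T` has fewer than `K` boxes, every good box shares a row or column block with `T`. These
  -- blocks hold at most `E.card / 2 + K * (A.card + B.card)` points, and the bad boxes at most `4 *
  -- K * (A.card + B.card)`. Together this contradicts the density constant `10`.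
  · exfalso
    have hbad : ∀ p q, ¬ good (p, q) → (E.filter fun x => g x.1 = p ∧ g' x.2 = q).card ≤
        (A.filter fun i => g i = p).card + (B.filter fun i => g' i = q).card := by
      intro p q hpq
      refine card_le_of_no_decreasing ?_ ?_
      · intro x hx
        obtain ⟨h1, h2, h3⟩ := Finset.mem_filter.1 hx
        exact Finset.mem_product.2 ⟨Finset.mem_filter.2 ⟨hA x h1, h2⟩,
          Finset.mem_filter.2 ⟨hB x h1, h3⟩⟩
      · intro a b c d hab hcd h1 h2
        obtain ⟨u1, u2, u3⟩ := Finset.mem_filter.1 h1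
        obtain ⟨v1, v2, v3⟩ := Finset.mem_filter.1 h2
        exact hpq ⟨a, b, c, d, hab, hcd, u1, v1, u2, v2, v3, u3⟩
    have hshare : ∀ t, t.1 < N → t.2 < N → good t → ∃ s ∈ T, s.1 = t.1 ∨ s.2 = t.2 := by
      intro t h1 h2 ht
      by_contra! hno
      have htT : t ∉ T := fun h => (hno t h).1 rfl
      have := hTmax (insert t T) (by
        rw [Finset.mem_filter, Finset.mem_powerset]
        refine ⟨Finset.insert_subset (by simp [h1, h2]) hTN, ?_, ?_⟩
        · intro s hs
          rcases Finset.mem_insert.1 hs with rfl | hs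
          · exact ht
          · exact hTgood s hs
        · intro s hs u hu hsu
          rcases Finset.mem_insert.1 hs with rfl | hsT <;>
            rcases Finset.mem_insert.1 hu with rfl | huT
          · exact absurd rfl hsu
          · exact ⟨(hno u huT).1.symm, (hno u huT).2.symm⟩
          · exact hno s hsT
          · exact hTind s hsT u huT hsu)
      rw [Finset.card_insert_of_notMem htT] at this
      omega
    have hcover : E ⊆ (T.biUnion fun t => E.filter fun x => g x.1 = t.1) ∪
        ((T.biUnion fun t => E.filter fun x => g' x.2 = t.2) ∪
        ((Finset.range N ×ˢ Finset.range N).filter fun t => ¬ good t).biUnion fun t =>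
          E.filter fun x => g x.1 = t.1 ∧ g' x.2 = t.2) := by
      intro x hx
      have h1 := hgN x hx
      have h2 := hgN' x hx
      simp only [Finset.mem_union, Finset.mem_biUnion, Finset.mem_filter]
      by_cases hgood : good (g x.1, g' x.2)
      · obtain ⟨s, hs, h | h⟩ := hshare _ h1 h2 hgood
        · exact Or.inl ⟨s, hs, hx, h.symm⟩
        · exact Or.inr (Or.inl ⟨s, hs, hx, h.symm⟩)
      · exact Or.inr (Or.inr ⟨(g x.1, g' x.2), ⟨by simp [h1, h2], hgood⟩, hx, rfl, rfl⟩)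
    have hle := (Finset.card_le_card hcover).trans ((Finset.card_union_le _ _).trans
      (Nat.add_le_add_left (Finset.card_union_le _ _) _))
    have hrow : N * (T.biUnion fun t => E.filter fun x => g x.1 = t.1).card ≤
        K * (E.card + N * B.card) := by
      refine (Nat.mul_le_mul_left N Finset.card_biUnion_le).trans ?_
      rw [Finset.mul_sum]
      refine (Finset.sum_le_card_nsmul T _ _ fun t _ => hgc t.1).trans ?_
      rw [smul_eq_mul]
      exact Nat.mul_le_mul_right _ (by omega)
    have hcol : N * (T.biUnion fun t => E.filter fun x => g' x.2 = t.2).card ≤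
        K * (E.card + N * A.card) := by
      refine (Nat.mul_le_mul_left N Finset.card_biUnion_le).trans ?_
      rw [Finset.mul_sum]
      refine (Finset.sum_le_card_nsmul T _ _ fun t _ => hgc' t.2).trans ?_
      rw [smul_eq_mul]
      exact Nat.mul_le_mul_right _ (by omega)
    have hbox : (((Finset.range N ×ˢ Finset.range N).filter fun t => ¬ good t).biUnion fun t =>
        E.filter fun x => g x.1 = t.1 ∧ g' x.2 = t.2).card ≤ N * (A.card + B.card) := by
      refine Finset.card_biUnion_le.trans ?_
      refine (Finset.sum_le_sum fun t ht => hbad t.1 t.2 (Finset.mem_filter.1 ht).2).trans ?_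
      refine (Finset.sum_le_sum_of_subset (Finset.filter_subset _ _)).trans ?_
      rw [Finset.sum_product]
      simp only [Finset.sum_add_distrib, Finset.sum_const, Finset.card_range, smul_eq_mul,
        ← Finset.mul_sum]
      rw [mul_add]
      exact Nat.add_le_add (Nat.mul_le_mul_left _ (sum_card_filter_eq_le A g N))
        (Nat.mul_le_mul_left _ (sum_card_filter_eq_le B g' N))
    have h1 := Nat.mul_le_mul_left N hle
    have h2 := Nat.mul_le_mul_left N hbox
    rw [mul_add, mul_add] at h1
    have h3 : K * (10 * K * (A.card + B.card)) < K * E.card := Nat.mul_lt_mul_of_pos_left hcard hK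
    have hN2 : N * (N * (A.card + B.card)) = 16 * (K * (K * (A.card + B.card))) := by rw [hN]; ring
    have hNE : N * E.card = 4 * (K * E.card) := by rw [hN]; ring
    have hr1 : K * (E.card + N * B.card) = K * E.card + 4 * (K * (K * B.card)) := by rw [hN]; ring
    have hr2 : K * (E.card + N * A.card) = K * E.card + 4 * (K * (K * A.card)) := by rw [hN]; ring
    have hs : K * (K * (A.card + B.card)) = K * (K * A.card) + K * (K * B.card) := by ring
    have h4 : K * (10 * K * (A.card + B.card)) = 10 * (K * (K * (A.card + B.card))) := by ring
    omega

/-! ### Enumerating orbits; packing and hitting intervals -/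

/-- The elements of an invariant set can be listed along the orbits of an injective map; `F` is the
set of last positions of the orbits. -/
theorem exists_orbit_enumeration {α : Type*} [Finite α] [Nonempty α] {σ : α → α} (hσ : Function.Injective σ)
    (n : ℕ) (A : Finset α) (hn : A.card = n) (hA : ∀ a ∈ A, σ a ∈ A) :
    ∃ (x : ℕ → α) (F : Finset ℕ), (∀ i < n, x i ∈ A) ∧
      (∀ i < n, ∀ j < n, i ≠ j → x i ≠ x j) ∧
      (∀ i < n, i ∉ F → i + 1 < n ∧ σ (x i) = x (i + 1)) ∧
      ∀ f ∈ F, f < n ∧ ∃ g ≤ f, (∀ i ∈ F, g ≤ i → f ≤ i) ∧ σ (x f) = x g := by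
  classical
  induction n using Nat.strong_induction_on generalizing A with
  | _ n ih =>
  rcases A.eq_empty_or_nonempty with rfl | ⟨a, ha⟩
  · rw [Finset.card_empty] at hn
    subst hn
    exact ⟨fun _ => Classical.arbitrary α, ∅, by simp⟩
  set m := Function.minimalPeriod σ a with hm
  have hper : a ∈ Function.periodicPts σ := hσ.mem_periodicPts a
  have hm0 : 0 < m := Function.minimalPeriod_pos_of_mem_periodicPts hper
  have hperm : σ^[m] a = a := Function.iterate_minimalPeriod
  have hinj : ∀ i < m, ∀ j < m, σ^[i] a = σ^[j] a → i = j := fun i hi j hj h =>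
    Function.iterate_injOn_Iio_minimalPeriod hi hj h
  have horb : ∀ i, σ^[i] a ∈ A := by
    intro i
    induction i with
    | zero => exact ha
    | succ i ihi => rw [Function.iterate_succ_apply']; exact hA _ ihi
  -- The orbit of `a` takes the positions below `m`; the remaining elements are still invariant
  -- under `σ` and are enumerated after it.
  set O := (Finset.range m).image fun i => σ^[i] a with hO
  have hOA : O ⊆ A := by
    intro y hy
    obtain ⟨i, -, rfl⟩ := Finset.mem_image.1 hy
    exact horb i
  have hOcard : O.card = m := by
    rw [hO, Finset.card_image_of_injOn, Finset.card_range]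
    intro i hi j hj h
    exact hinj i (by simpa using hi) j (by simpa using hj) h
  have hcard : (A \ O).card = n - m := by
    rw [Finset.card_sdiff_of_subset hOA, hn, hOcard]
  have hmn : m ≤ n := by rw [← hOcard, ← hn]; exact Finset.card_le_card hOA
  have hinv : ∀ b ∈ A \ O, σ b ∈ A \ O := by
    intro b hb
    rw [Finset.mem_sdiff] at hb ⊢
    refine ⟨hA b hb.1, fun hbO => hb.2 ?_⟩
    obtain ⟨i, hi, hib⟩ := Finset.mem_image.1 hbO
    rw [Finset.mem_range] at hi
    rcases i with _ | i
    · refine Finset.mem_image.2 ⟨m - 1, by simpa using hm0, hσ ?_⟩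
      rw [← hib, ← Function.iterate_succ_apply' σ, Nat.succ_eq_add_one,
        Nat.sub_add_cancel hm0, hperm]
      rfl
    · refine Finset.mem_image.2 ⟨i, by simp; omega, hσ ?_⟩
      rw [← hib, ← Function.iterate_succ_apply' σ]
  obtain ⟨y, F, hyA, hyinj, hystep, hyF⟩ := ih (n - m) (by omega) (A \ O) hcard hinv
  refine ⟨fun i => if i < m then σ^[i] a else y (i - m), insert (m - 1) (F.image (· + m)),
    ?_, ?_, ?_, ?_⟩
  · intro i hi
    by_cases him : i < m
    · simp only [him, if_true]; exact horb i
    · simp only [him, if_false]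
      exact (Finset.mem_sdiff.1 (hyA (i - m) (by omega))).1
  · have hcross : ∀ i < m, ∀ j < n, ¬ j < m → σ^[i] a ≠ y (j - m) := by
      intro i hi j hj hjm heq
      refine (Finset.mem_sdiff.1 (hyA (j - m) (by omega))).2 (heq ▸ ?_)
      exact Finset.mem_image.2 ⟨i, by simpa using hi, rfl⟩
    intro i hi j hj hij
    by_cases him : i < m <;> by_cases hjm : j < m <;> simp only [him, hjm, if_true, if_false]
    · exact fun h => hij (hinj i him j hjm h)
    · exact hcross i him j hj hjm
    · exact (hcross j hjm i hi him).symm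
    · exact hyinj _ (by omega) _ (by omega) (by omega)
  · intro i hi hiF
    rw [Finset.mem_insert, Finset.mem_image] at hiF
    push Not at hiF
    by_cases him : i < m
    · have : i + 1 < m := by omega
      simp only [him, this, if_true]
      exact ⟨by omega, (Function.iterate_succ_apply' σ i a).symm⟩
    · obtain ⟨h1, h2⟩ := hystep (i - m) (by omega) fun h => hiF.2 (i - m) h (by omega)
      have : ¬ i + 1 < m := by omega
      simp only [him, this, if_false]
      refine ⟨by omega, ?_⟩
      rw [h2]
      congr 1
      omega
  · intro f hf
    rcases Finset.mem_insert.1 hf with rfl | hf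
    · refine ⟨by omega, 0, by omega, ?_, ?_⟩
      · intro i hi _
        rcases Finset.mem_insert.1 hi with rfl | hi
        · exact le_rfl
        · obtain ⟨j, -, rfl⟩ := Finset.mem_image.1 hi
          omega
      · have h1 : m - 1 < m := by omega
        simp only [h1, hm0, if_true]
        rw [← Function.iterate_succ_apply' σ, Nat.succ_eq_add_one, Nat.sub_add_cancel hm0, hperm]
        rfl
    · obtain ⟨f', hf', rfl⟩ := Finset.mem_image.1 hf
      obtain ⟨h1, g, hg, hgF, hfg⟩ := hyF f' hf'
      refine ⟨by omega, g + m, by omega, ?_, ?_⟩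
      · intro i hi hgi
        rcases Finset.mem_insert.1 hi with rfl | hi
        · omega
        · obtain ⟨j, hj, rfl⟩ := Finset.mem_image.1 hi
          have := hgF j hj (by omega)
          omega
      · simpa using hfg

/-- Either there are `K` disjoint intervals with property `P`, or fewer than `K` points meet all such
intervals. -/
theorem exists_intervals_or_hitting (P : ℕ → ℕ → Prop) (n K : ℕ) :
    (∃ (T : Finset ℕ) (a : ℕ → ℕ), T.card = K ∧ (∀ t ∈ T, a t ≤ t ∧ t < n ∧ P (a t) t) ∧
      ∀ s ∈ T, ∀ t ∈ T, s < t → s < a t) ∨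
    ∃ H : Finset ℕ, H.card < K ∧ ∀ i j, i ≤ j → j < n → P i j → ∃ h ∈ H, i ≤ h ∧ h ≤ j := by
  classical
  suffices ∀ m, (∃ (T : Finset ℕ) (a : ℕ → ℕ), T.card = K ∧
      (∀ t ∈ T, m ≤ a t ∧ a t ≤ t ∧ t < n ∧ P (a t) t) ∧ ∀ s ∈ T, ∀ t ∈ T, s < t → s < a t) ∨
      ∃ H : Finset ℕ, H.card < K ∧
        ∀ i j, m ≤ i → i ≤ j → j < n → P i j → ∃ h ∈ H, i ≤ h ∧ h ≤ j by
    rcases this 0 with ⟨T, a, h1, h2, h3⟩ | ⟨H, h1, h2⟩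
    · exact Or.inl ⟨T, a, h1, fun t ht => (h2 t ht).2, h3⟩
    · exact Or.inr ⟨H, h1, fun i j => h2 i j (Nat.zero_le _)⟩
  induction K with
  | zero => exact fun m => Or.inl ⟨∅, id, by simp⟩
  | succ K ih =>
    intro m
    -- Greedy choice of the smallest right end `j₀`: every admissible interval either contains `j₀`
    -- or lies entirely to its right.
    by_cases hex : ∃ j, j < n ∧ ∃ i, m ≤ i ∧ i ≤ j ∧ P i j
    · obtain ⟨hjn, i₀, hmi, hij, hP⟩ := Nat.find_spec hex
      have hmin := fun l hl => Nat.find_min hex (m := l) hl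
      set j₀ := Nat.find hex
      rcases ih (j₀ + 1) with ⟨T, a, h1, h2, h3⟩ | ⟨H, h1, h2⟩
      · have hjT : j₀ ∉ T := fun h => by
          have := h2 _ h
          omega
        refine Or.inl ⟨insert j₀ T, Function.update a j₀ i₀, ?_, ?_, ?_⟩
        · rw [Finset.card_insert_of_notMem hjT, h1]
        · intro t ht
          rcases Finset.mem_insert.1 ht with rfl | ht
          · simpa using ⟨hmi, hij, hjn, hP⟩
          · obtain ⟨u1, u2, u3, u4⟩ := h2 t ht
            rw [Function.update_of_ne (by rintro rfl; exact hjT ht)]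
            exact ⟨by omega, u2, u3, u4⟩
        · intro s hs t ht hst
          rcases Finset.mem_insert.1 ht with rfl | ht
          · rcases Finset.mem_insert.1 hs with rfl | hs
            · omega
            · have := h2 s hs
              omega
          · rw [Function.update_of_ne (by rintro rfl; exact hjT ht)]
            rcases Finset.mem_insert.1 hs with rfl | hs
            · have := h2 t ht
              omega
            · exact h3 s hs t ht hst
      · refine Or.inr ⟨insert j₀ H, (Finset.card_insert_le _ _).trans_lt (by omega), ?_⟩
        intro i j hmi hij hjn hP
        by_cases hi : i ≤ j₀
        · refine ⟨j₀, Finset.mem_insert_self _ _, hi, ?_⟩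
          by_contra! hlt
          exact hmin j hlt ⟨hjn, i, hmi, hij, hP⟩
        · obtain ⟨h, hh, h'⟩ := h2 i j (by omega) hij hjn hP
          exact ⟨h, Finset.mem_insert_of_mem hh, h'⟩
    · push Not at hex
      exact Or.inr ⟨∅, by simp, fun i j hmi hij hjn hP => absurd hP (hex j hjn i hmi hij)⟩

/-! ### Threads and the cycles they contain -/

/-- A sequence of disjoint paths `L i`, from `s i` to `e i`, with disjoint connecting paths `M i`.
For `i ∉ F` the path `M i` leads from `e i` to `s (i + 1)`; for `i ∈ F` it leads back to the first
path after the previous element of `F`. -/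
structure IsThread (r : V → V → Prop) (n : ℕ) (F : Finset ℕ) (L M : ℕ → Set V) (s e : ℕ → V) :
    Prop where
  start_mem : ∀ i < n, s i ∈ L i
  start_ne_end : ∀ i < n, s i ≠ e i
  reach_start : ∀ i < n, ∀ v ∈ L i, ReachIn r (L i) (s i) v
  reach_end : ∀ i < n, ∀ v ∈ L i, ReachIn r (L i) v (e i)
  end_mem : ∀ i < n, e i ∈ M i
  back_start : ∀ i < n, ∀ v ∈ M i, ReachIn r (M i) (e i) v
  back_end : ∀ i < n, i ∉ F → i + 1 < n ∧ ∀ v ∈ M i, ReachIn r (M i) v (s (i + 1))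
  closed : ∀ f ∈ F, f < n ∧ ∃ g ≤ f, (∀ i ∈ F, g ≤ i → f ≤ i) ∧ ReachIn r (M f) (e f) (s g)
  disjoint : ∀ i < n, ∀ j < n, i ≠ j → Disjoint (L i) (L j)
  back_disjoint : ∀ i < n, ∀ j < n, i ≠ j → Disjoint (M i) (M j)

/-- The union of the sets with index in `I`. -/
def span (L : ℕ → Set V) (I : Set ℕ) : Set V := ⋃ i ∈ I, L i

theorem mem_span {L : ℕ → Set V} {I : Set ℕ} {v : V} : v ∈ span L I ↔ ∃ i ∈ I, v ∈ L i := by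
  simp [span]

theorem subset_span {L : ℕ → Set V} {I : Set ℕ} {i : ℕ} (hi : i ∈ I) : L i ⊆ span L I :=
  fun _ hv => mem_span.2 ⟨i, hi, hv⟩

theorem span_mono {L : ℕ → Set V} {I J : Set ℕ} (h : I ⊆ J) : span L I ⊆ span L J := by
  intro v hv
  obtain ⟨i, hi, hv⟩ := mem_span.1 hv
  exact mem_span.2 ⟨i, h hi, hv⟩

theorem disjoint_span {L : ℕ → Set V} {n : ℕ}
    (h : ∀ i < n, ∀ j < n, i ≠ j → Disjoint (L i) (L j)) {I J : Set ℕ} (hI : ∀ i ∈ I, i < n)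
    (hJ : ∀ j ∈ J, j < n) (hIJ : Disjoint I J) : Disjoint (span L I) (span L J) := by
  rw [Set.disjoint_left]
  intro v hv hv'
  obtain ⟨i, hi, hv⟩ := mem_span.1 hv
  obtain ⟨j, hj, hv'⟩ := mem_span.1 hv'
  refine Set.disjoint_left.1 (h i (hI i hi) j (hJ j hj) ?_) hv hv'
  rintro rfl
  exact Set.disjoint_left.1 hIJ hi hj

/-- The part of a thread from the path `L i` to the path `L j`. -/
def threadPart (L M : ℕ → Set V) (i j : ℕ) : Set V :=
  span L (Set.Icc i j) ∪ span M (Set.Ico i j)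

/-- The part of a thread from the path `L i` up to and including the connecting path `M j`. -/
def threadHull (L M : ℕ → Set V) (i j : ℕ) : Set V :=
  span L (Set.Icc i j) ∪ span M (Set.Icc i j)

theorem threadPart_mono {L M : ℕ → Set V} {i j i' j' : ℕ} (hi : i' ≤ i) (hj : j ≤ j') :
    threadPart L M i j ⊆ threadPart L M i' j' :=
  Set.union_subset_union (span_mono (Set.Icc_subset_Icc hi hj))
    (span_mono (Set.Ico_subset_Ico hi hj))

theorem threadPart_subset_threadHull (L M : ℕ → Set V) (i j : ℕ) :
    threadPart L M i j ⊆ threadHull L M i j :=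
  Set.union_subset_union_right _ (span_mono Set.Ico_subset_Icc_self)

theorem threadHull_mono {L M : ℕ → Set V} {i j i' j' : ℕ} (hi : i' ≤ i) (hj : j ≤ j') :
    threadHull L M i j ⊆ threadHull L M i' j' :=
  Set.union_subset_union (span_mono (Set.Icc_subset_Icc hi hj))
    (span_mono (Set.Icc_subset_Icc hi hj))

namespace IsThread

variable {r : V → V → Prop} {n : ℕ} {F : Finset ℕ} {L M : ℕ → Set V} {s e : ℕ → V}

/-- The condition on `F` excludes breaks in the half-open interval from `i` to `j`; a break at `j`
itself is harmless, as `M j` is not used. -/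
theorem reach_starts (h : IsThread r n F L M s e) {i j : ℕ} (hij : i ≤ j) (hj : j < n)
    (hF : ∀ f ∈ F, i ≤ f → j ≤ f) : ReachIn r (threadPart L M i j) (s i) (s j) := by
  induction j, hij using Nat.le_induction with
  | base => exact ReachIn.refl _
  | succ j hij ih =>
    have hj' : j < n := by omega
    have hjF : j ∉ F := fun hf => by
      have := hF j hf hij
      omega
    have h1 := (ih hj' fun f hf hif => by have := hF f hf hif; omega).mono
      (threadPart_mono (L := L) (M := M) le_rfl (Nat.le_succ j))
    have h2 := (h.reach_end j hj' (s j) (h.start_mem j hj')).mono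
      ((subset_span (L := L) (Set.mem_Icc.2 ⟨hij, Nat.le_succ j⟩)).trans
      (Set.subset_union_left (t := span M (Set.Ico i (j + 1)))))
    have h3 := ((h.back_end j hj' hjF).2 (e j) (h.end_mem j hj')).mono
      ((subset_span (L := M) (Set.mem_Ico.2 ⟨hij, Nat.lt_succ_self j⟩)).trans
      (Set.subset_union_right (s := span L (Set.Icc i (j + 1)))))
    exact (h1.trans h2).trans h3

theorem subset_threadPart {i j l : ℕ} (hi : i ≤ l) (hj : l ≤ j) : L l ⊆ threadPart L M i j :=
  (subset_span (Set.mem_Icc.2 ⟨hi, hj⟩)).trans Set.subset_union_left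

theorem back_subset_threadPart {i j l : ℕ} (hi : i ≤ l) (hj : l < j) : M l ⊆ threadPart L M i j :=
  (subset_span (Set.mem_Ico.2 ⟨hi, hj⟩)).trans Set.subset_union_right

theorem subset_threadHull {i j l : ℕ} (hi : i ≤ l) (hj : l ≤ j) : L l ⊆ threadHull L M i j :=
  (subset_span (Set.mem_Icc.2 ⟨hi, hj⟩)).trans Set.subset_union_left

theorem back_subset_threadHull {i j l : ℕ} (hi : i ≤ l) (hj : l ≤ j) : M l ⊆ threadHull L M i j :=
  (subset_span (Set.mem_Icc.2 ⟨hi, hj⟩)).trans Set.subset_union_right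

/-- A vertex of a connecting path reaches the start of every later path. -/
theorem reach_start_of_back (h : IsThread r n F L M s e) {i j : ℕ} (hij : i < j) (hj : j < n)
    (hF : ∀ f ∈ F, i ≤ f → j ≤ f) {v : V} (hv : v ∈ M i) :
    ReachIn r (threadPart L M i j) v (s j) := by
  have hiF : i ∉ F := fun hf => by
    have := hF i hf le_rfl
    omega
  exact (((h.back_end i (by omega) hiF).2 v hv).mono (back_subset_threadPart le_rfl hij)).trans
    ((h.reach_starts hij hj fun f hf hif => hF f hf (by omega)).mono
      (threadPart_mono (Nat.le_succ i) le_rfl))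

theorem reach_between (h : IsThread r n F L M s e) {i j : ℕ} (hij : i < j) (hj : j < n)
    (hF : ∀ f ∈ F, i ≤ f → j ≤ f) {u v : V} (hu : u ∈ L i) (hv : v ∈ L j) :
    ReachIn r (threadPart L M i j) u v :=
  (((h.reach_end i (by omega) u hu).mono (subset_threadPart le_rfl hij.le)).trans
    (h.reach_start_of_back hij hj hF (h.end_mem i (by omega)))).trans
    ((h.reach_start j hj v hv).mono (subset_threadPart hij.le le_rfl))

theorem ne_of_mem (h : IsThread r n F L M s e) {i j : ℕ} (hi : i < n) (hj : j < n) (hij : i ≠ j)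
    {u v : V} (hu : u ∈ L i) (hv : v ∈ L j) : u ≠ v := by
  rintro rfl
  exact Set.disjoint_left.1 (h.disjoint i hi j hj hij) hu hv

variable {G : Digraph V}

/-- A break `f` returns to the beginning of its own orbit, so the stretch from there to `f` closes
up. Having many breaks is thus already enough for a packing. -/
theorem hasCycleIn_orbit (h : IsThread G.Adj n F L M s e) {f : ℕ} (hf : f ∈ F) :
    ∃ g ≤ f, (∀ i ∈ F, g ≤ i → f ≤ i) ∧ G.HasCycleIn (threadHull L M g f) := by
  obtain ⟨hfn, g, hgf, hF, hback⟩ := h.closed f hf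
  refine ⟨g, hgf, hF, ?_⟩
  have h1 := (h.reach_starts hgf hfn hF).mono (threadPart_subset_threadHull L M g f)
  have h2 := (h.reach_end f hfn _ (h.start_mem f hfn)).mono
    (subset_threadHull (L := L) (M := M) hgf le_rfl)
  have h3 := hback.mono (back_subset_threadHull (L := L) (M := M) hgf le_rfl)
  exact hasCycleIn_of_transGen (v := s f)
    (((h2.transGen (h.start_ne_end f hfn)).trans_left h3).trans_left h1)

theorem hasCycleIn_of_mem_inter (h : IsThread G.Adj n F L M s e) {i j : ℕ} (hij : i < j)
    (hj : j < n) (hF : ∀ f ∈ F, i ≤ f → j ≤ f) {v : V} (hv : v ∈ L i) (hv' : v ∈ M j) :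
    G.HasCycleIn (threadHull L M i j) := by
  have h1 := (h.reach_between hij hj hF hv (h.start_mem j hj)).mono
    (threadPart_subset_threadHull L M i j)
  have h2 := (h.reach_end j hj _ (h.start_mem j hj)).mono
    (subset_threadHull (L := L) (M := M) hij.le le_rfl)
  have h3 := (h.back_start j hj v hv').mono (back_subset_threadHull (L := L) (M := M) hij.le le_rfl)
  have hne := h.ne_of_mem (by omega) hj hij.ne hv (h.start_mem j hj)
  exact hasCycleIn_of_transGen (((h1.transGen hne).trans_left h2).trans_left h3)

/-- Adjacent indices must be excluded: away from breaks, `M i` ends at the start of `L (i + 1)`, and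
that meeting need not give a cycle. -/
theorem hasCycleIn_of_mem_inter' (h : IsThread G.Adj n F L M s e) {i j : ℕ} (hij : i + 1 < j)
    (hj : j < n) (hF : ∀ f ∈ F, i ≤ f → j ≤ f) {v : V} (hv : v ∈ M i) (hv' : v ∈ L j) :
    G.HasCycleIn (threadHull L M i j) := by
  have h1 := (h.reach_start_of_back (by omega) (by omega) (fun f hf hif => by
    have := hF f hf hif; omega) hv).mono
    ((threadPart_subset_threadHull L M i (i + 1)).trans (threadHull_mono le_rfl hij.le))
  have h2 := (h.reach_between hij hj (fun f hf hif => hF f hf (by omega))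
    (h.start_mem (i + 1) (by omega)) hv').mono
    ((threadPart_subset_threadHull L M (i + 1) j).trans (threadHull_mono (Nat.le_succ i) le_rfl))
  have hne := h.ne_of_mem hj (by omega) (by omega) hv' (h.start_mem (i + 1) (by omega))
  exact hasCycleIn_of_transGen ((h1.transGen hne).trans_left h2)

/-- Only a forward path of one part and a connecting path of the other can meet, and this closes a
cycle. As `threadPart` omits the last connecting path, `M i` with `i < b` and `L j` with `a' ≤ j`
are never adjacent. -/
theorem disjoint_threadPart (h : IsThread G.Adj n F L M s e) {a b a' b' : ℕ}
    (hba : b < a') (hb' : b' < n) (hF : ∀ f ∈ F, a ≤ f → b' ≤ f)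
    (hcyc : ¬ G.HasCycleIn (threadHull L M a b')) :
    Disjoint (threadPart L M a b) (threadPart L M a' b') := by
  rw [Set.disjoint_left]
  rintro v (hv | hv) (hv' | hv') <;> obtain ⟨i, ⟨hi, hi'⟩, hvi⟩ := mem_span.1 hv <;>
    obtain ⟨j, ⟨hj, hj'⟩, hvj⟩ := mem_span.1 hv'
  · exact Set.disjoint_left.1 (h.disjoint i (by omega) j (by omega) (by omega)) hvi hvj
  · exact hcyc ((h.hasCycleIn_of_mem_inter (by omega) (by omega) (fun f hf hif => by
      have := hF f hf (by omega); omega) hvi hvj).mono (threadHull_mono (by omega) (by omega)))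
  · exact hcyc ((h.hasCycleIn_of_mem_inter' (by omega) (by omega) (fun f hf hif => by
      have := hF f hf (by omega); omega) hvi hvj).mono (threadHull_mono (by omega) (by omega)))
  · exact Set.disjoint_left.1 (h.back_disjoint i (by omega) j (by omega) (by omega)) hvi hvj

/-- The two layers are the forward paths and the connecting paths, each disjoint over disjoint index
intervals. -/
theorem hasCyclePacking_of_intervals (h : IsThread G.Adj n F L M s e) {k : ℕ} (T : Finset ℕ)
    (a : ℕ → ℕ) (hT : ∀ t ∈ T, t < n ∧ G.HasCycleIn (threadHull L M (a t) t))
    (hdisj : ∀ s ∈ T, ∀ t ∈ T, s < t → s < a t) (hcard : 2 * k ≤ T.card) :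
    G.HasCyclePacking 2 k := by
  have hI : ∀ s ∈ T, ∀ t ∈ T, s ≠ t → Disjoint (Set.Icc (a s) s) (Set.Icc (a t) t) := by
    intro s hs t ht hst
    rw [Set.disjoint_left]
    rintro x ⟨h1, h2⟩ ⟨h3, h4⟩
    rcases hst.lt_or_gt with hlt | hlt
    · have := hdisj s hs t ht hlt
      omega
    · have := hdisj t ht s hs hlt
      omega
  have hlt : ∀ t ∈ T, ∀ i ∈ Set.Icc (a t) t, i < n := fun t ht i hi =>
    lt_of_le_of_lt hi.2 (hT t ht).1
  refine hasCyclePacking_of_layers (by omega) T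
    ![fun t => span L (Set.Icc (a t) t), fun t => span M (Set.Icc (a t) t)] ?_ ?_ hcard
  · intro i
    fin_cases i
    · exact fun s hs t ht hst => disjoint_span h.disjoint (hlt s hs) (hlt t ht) (hI s hs t ht hst)
    · exact fun s hs t ht hst =>
        disjoint_span h.back_disjoint (hlt s hs) (hlt t ht) (hI s hs t ht hst)
  · intro t ht
    refine (hT t ht).2.mono ?_
    rintro v (hv | hv)
    · exact Set.mem_iUnion.2 ⟨0, hv⟩
    · exact Set.mem_iUnion.2 ⟨1, hv⟩

theorem hasCyclePacking_of_orbits (h : IsThread G.Adj n F L M s e) {k : ℕ} (hF : 2 * k ≤ F.card) :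
    G.HasCyclePacking 2 k := by
  have hex : ∀ f, ∃ g, f ∈ F → g ≤ f ∧ (∀ i ∈ F, g ≤ i → f ≤ i) ∧
      G.HasCycleIn (threadHull L M g f) := by
    intro f
    by_cases hf : f ∈ F
    · obtain ⟨g, hg⟩ := h.hasCycleIn_orbit hf
      exact ⟨g, fun _ => hg⟩
    · exact ⟨0, fun h => absurd h hf⟩
  choose g hg using hex
  refine h.hasCyclePacking_of_intervals F g (fun f hf => ⟨(h.closed f hf).1, (hg f hf).2.2⟩) ?_ hF
  intro f hf f' hf' hlt
  by_contra! hle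
  have := (hg f' hf').2.1 f hf hle
  omega

/-- Without a half-integral packing, few positions meet all breaks and all parts of the thread that
contain a cycle. -/
theorem exists_hitting (h : IsThread G.Adj n F L M s e) {k : ℕ} (hk : ¬ G.HasCyclePacking 2 k) :
    ∃ H : Finset ℕ, H.card < 4 * k ∧ F ⊆ H ∧
      ∀ i j, i ≤ j → j < n → G.HasCycleIn (threadHull L M i j) → ∃ x ∈ H, i ≤ x ∧ x ≤ j := by
  classical
  have hF : F.card < 2 * k := by
    by_contra! hF
    exact hk (h.hasCyclePacking_of_orbits hF)
  rcases exists_intervals_or_hitting (fun i j => G.HasCycleIn (threadHull L M i j)) n (2 * k) with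
    ⟨T, a, hT, h1, h2⟩ | ⟨H, hH, h1⟩
  · exact absurd (h.hasCyclePacking_of_intervals T a (fun t ht => (h1 t ht).2) h2 hT.ge) hk
  · refine ⟨F ∪ H, (Finset.card_union_le _ _).trans_lt (by omega), Finset.subset_union_left, ?_⟩
    intro i j hij hj hc
    obtain ⟨x, hx, hx'⟩ := h1 i j hij hj hc
    exact ⟨x, Finset.mem_union_right _ hx, hx'⟩

variable {n' : ℕ} {F' : Finset ℕ} {L' M' : ℕ → Set V} {s' e' : ℕ → V}

/-- Two threads that meet in the reverse order form a cycle. -/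
theorem hasCycleIn_of_crossing (h : IsThread G.Adj n F L M s e)
    (h' : IsThread G.Adj n' F' L' M' s' e')
    {a b c d : ℕ} (hab : a < b) (hb : b < n) (hcd : c < d) (hd : d < n')
    (hF : ∀ f ∈ F, a ≤ f → b ≤ f) (hF' : ∀ f ∈ F', c ≤ f → d ≤ f)
    (had : ¬ Disjoint (L a) (L' d)) (hbc : ¬ Disjoint (L b) (L' c)) :
    G.HasCycleIn (threadPart L M a b ∪ threadPart L' M' c d) := by
  obtain ⟨u, hu, hu'⟩ := Set.not_disjoint_iff.1 had
  obtain ⟨v, hv, hv'⟩ := Set.not_disjoint_iff.1 hbc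
  have h1 := (h.reach_between hab hb hF hu hv).mono
    (Set.subset_union_left (t := threadPart L' M' c d))
  have h2 := (h'.reach_between hcd hd hF' hv' hu').mono
    (Set.subset_union_right (s := threadPart L M a b))
  have hne := h.ne_of_mem (by omega) hb hab.ne hu hv
  exact hasCycleIn_of_transGen ((h1.transGen hne).trans_left h2)

end IsThread

/-! ### Two threads that meet often -/

/-- Each break lies in at most one of the disjoint intervals, so few boxes are spoiled by breaks. -/
theorem card_filter_interval_meets_le {ι : Type*} (T : Finset ι) (F : Finset ℕ) (a b : ι → ℕ)
    (h : ∀ s ∈ T, ∀ t ∈ T, s ≠ t → b s < a t ∨ b t < a s) :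
    (T.filter fun t => ∃ f ∈ F, a t ≤ f ∧ f < b t).card ≤ F.card := by
  classical
  have hex : ∀ t, ∃ f, (∃ f ∈ F, a t ≤ f ∧ f < b t) → f ∈ F ∧ a t ≤ f ∧ f < b t := by
    intro t
    by_cases ht : ∃ f ∈ F, a t ≤ f ∧ f < b t
    · obtain ⟨f, hf⟩ := ht
      exact ⟨f, fun _ => hf⟩
    · exact ⟨0, fun h => absurd h ht⟩
  choose f hf using hex
  refine Finset.card_le_card_of_injOn f (fun t ht => (hf t (Finset.mem_filter.1 ht).2).1) ?_
  intro s hs t ht hst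
  by_contra hne
  obtain ⟨hs1, hs2⟩ := Finset.mem_filter.1 hs
  obtain ⟨ht1, ht2⟩ := Finset.mem_filter.1 ht
  have e1 := (hf s hs2).2
  have e2 := (hf t ht2).2
  rw [← hst] at e2
  rcases h s hs1 t ht1 hne with h' | h' <;> omega

namespace IsThread

variable {G : Digraph V} {n : ℕ} {F F' : Finset ℕ} {L M L' M' : ℕ → Set V} {s e s' e' : ℕ → V}

open Classical in
/-- The pairs of positions at which two threads meet. -/
noncomputable def meetings (n : ℕ) (L L' : ℕ → Set V) : Finset (ℕ × ℕ) :=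
  (Finset.range n ×ˢ Finset.range n).filter fun x => ¬ Disjoint (L x.1) (L' x.2)

theorem mem_meetings {L L' : ℕ → Set V} {x : ℕ × ℕ} :
    x ∈ meetings n L L' ↔ (x.1 < n ∧ x.2 < n) ∧ ¬ Disjoint (L x.1) (L' x.2) := by
  simp [meetings]

/-- Two threads that meet often yield a quarter-integral packing. -/
theorem hasCyclePacking_four (h : IsThread G.Adj n F L M s e)
    (h' : IsThread G.Adj n F' L' M' s' e') {k : ℕ}
    (hE : 160 * k * n < (meetings n L L').card) : G.HasCyclePacking 4 k := by
  classical
  by_cases hF : 2 * k ≤ F.card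
  · exact (h.hasCyclePacking_of_orbits hF).mono (by omega) le_rfl
  by_cases hF' : 2 * k ≤ F'.card
  · exact (h'.hasCyclePacking_of_orbits hF').mono (by omega) le_rfl
  -- Of the `8 k` boxes at most `2 k` are spoiled by the breaks of each thread. The remaining `4 k`
  -- suffice for four layers.
  obtain ⟨T, a, b, c, d, hT, hbox, hsep⟩ := exists_decreasing_boxes (8 * k)
    (A := Finset.range n) (B := Finset.range n) (E := meetings n L L')
    (Finset.filter_subset _ _) (by
      rw [Finset.card_range]
      calc 10 * (8 * k) * (n + n) = 160 * k * n := by ring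
        _ < _ := hE)
  have hk1 := card_filter_interval_meets_le T F a b fun s hs t ht hst => (hsep s hs t ht hst).1
  have hk2 := card_filter_interval_meets_le T F' c d fun s hs t ht hst => (hsep s hs t ht hst).2
  set T₁ := T.filter fun t => ∃ f ∈ F, a t ≤ f ∧ f < b t with hT₁
  set T₂ := T.filter fun t => ∃ f ∈ F', c t ≤ f ∧ f < d t with hT₂
  have hcard : 4 * k ≤ (T \ (T₁ ∪ T₂)).card := by
    have h1 := Finset.le_card_sdiff (T₁ ∪ T₂) T
    have h2 := Finset.card_union_le T₁ T₂
    omega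
  have hn : ∀ t ∈ T, b t < n ∧ d t < n := fun t ht => by
    obtain ⟨-, -, h1, h2⟩ := hbox t ht
    exact ⟨(mem_meetings.1 h2).1.1, (mem_meetings.1 h1).1.2⟩
  have hI : ∀ {a b : ℕ × ℕ → ℕ} {s t}, b s < a t ∨ b t < a s →
      Disjoint (Set.Icc (a s) (b s)) (Set.Icc (a t) (b t)) := by
    intro a b s t hst
    rw [Set.disjoint_left]
    rintro x ⟨h1, h2⟩ ⟨h3, h4⟩
    omega
  have hTT : ∀ t ∈ T \ (T₁ ∪ T₂), t ∈ T := fun t ht => (Finset.mem_sdiff.1 ht).1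
  have hlt : ∀ t ∈ T \ (T₁ ∪ T₂), ∀ i ∈ Set.Icc (a t) (b t), i < n := fun t ht i hi =>
    lt_of_le_of_lt hi.2 (hn t (hTT t ht)).1
  have hlt' : ∀ t ∈ T \ (T₁ ∪ T₂), ∀ i ∈ Set.Icc (c t) (d t), i < n := fun t ht i hi =>
    lt_of_le_of_lt hi.2 (hn t (hTT t ht)).2
  have hdis : ∀ s ∈ T \ (T₁ ∪ T₂), ∀ t ∈ T \ (T₁ ∪ T₂), s ≠ t →
      Disjoint (Set.Icc (a s) (b s)) (Set.Icc (a t) (b t)) ∧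
      Disjoint (Set.Icc (c s) (d s)) (Set.Icc (c t) (d t)) := fun s hs t ht hst =>
    ⟨hI (hsep s (hTT s hs) t (hTT t ht) hst).1, hI (hsep s (hTT s hs) t (hTT t ht) hst).2⟩
  refine hasCyclePacking_of_layers (by omega) (T \ (T₁ ∪ T₂))
    ![fun t => span L (Set.Icc (a t) (b t)), fun t => span M (Set.Icc (a t) (b t)),
      fun t => span L' (Set.Icc (c t) (d t)), fun t => span M' (Set.Icc (c t) (d t))] ?_ ?_ hcard
  · intro i
    fin_cases i
    · exact fun s hs t ht hst =>
        disjoint_span h.disjoint (hlt s hs) (hlt t ht) (hdis s hs t ht hst).1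
    · exact fun s hs t ht hst =>
        disjoint_span h.back_disjoint (hlt s hs) (hlt t ht) (hdis s hs t ht hst).1
    · exact fun s hs t ht hst =>
        disjoint_span h'.disjoint (hlt' s hs) (hlt' t ht) (hdis s hs t ht hst).2
    · exact fun s hs t ht hst =>
        disjoint_span h'.back_disjoint (hlt' s hs) (hlt' t ht) (hdis s hs t ht hst).2
  · intro t ht
    obtain ⟨htT, htn⟩ := Finset.mem_sdiff.1 ht
    obtain ⟨hab, hcd, had, hbc⟩ := hbox t htT
    have hFt : ∀ f ∈ F, a t ≤ f → b t ≤ f := fun f hf haf => by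
      by_contra! hlt
      exact htn (Finset.mem_union_left _ (Finset.mem_filter.2 ⟨htT, f, hf, haf, hlt⟩))
    have hFt' : ∀ f ∈ F', c t ≤ f → d t ≤ f := fun f hf haf => by
      by_contra! hlt
      exact htn (Finset.mem_union_right _ (Finset.mem_filter.2 ⟨htT, f, hf, haf, hlt⟩))
    refine (h.hasCycleIn_of_crossing h' hab (hn t htT).1 hcd (hn t htT).2 hFt hFt'
      (mem_meetings.1 had).2 (mem_meetings.1 hbc).2).mono ?_
    refine (Set.union_subset_union (threadPart_subset_threadHull _ _ _ _)
      (threadPart_subset_threadHull _ _ _ _)).trans ?_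
    rintro v ((hv | hv) | (hv | hv))
    · exact Set.mem_iUnion.2 ⟨0, hv⟩
    · exact Set.mem_iUnion.2 ⟨1, hv⟩
    · exact Set.mem_iUnion.2 ⟨2, hv⟩
    · exact Set.mem_iUnion.2 ⟨3, hv⟩

/-- Two positions outside `H` with equally many elements of `H` below them are not separated by
`H`. -/
theorem forall_le_of_card_filter_eq {H : Finset ℕ} {i j : ℕ} (hj : j ∉ H)
    (hij : (H.filter (· < i)).card = (H.filter (· < j)).card) : ∀ x ∈ H, i ≤ x → j < x := by
  intro x hx hix
  by_contra! hle
  have hxj : x < j := lt_of_le_of_ne hle fun h => hj (h ▸ hx)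
  have hss : H.filter (· < i) ⊂ H.filter (· < j) := by
    rw [Finset.ssubset_iff_of_subset]
    · exact ⟨x, Finset.mem_filter.2 ⟨hx, hxj⟩, fun h => by
        have := (Finset.mem_filter.1 h).2
        omega⟩
    · exact Finset.monotone_filter_right _ fun y _ hy => by omega
  have := Finset.card_lt_card hss
  omega

/-- Two threads that meet very often yield a half-integral packing. -/
theorem hasCyclePacking_two (h : IsThread G.Adj n F L M s e)
    (h' : IsThread G.Adj n F' L' M' s' e') {k : ℕ}
    (hE : 168 * k ^ 2 * n < (meetings n L L').card) : G.HasCyclePacking 2 k := by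
  classical
  by_contra hk
  obtain ⟨H, hHc, hFH, hH⟩ := h.exists_hitting hk
  obtain ⟨H', hHc', hFH', hH'⟩ := h'.exists_hitting hk
  have hk0 : 1 ≤ k := by omega
  set lab : ℕ → ℕ := fun i => (H.filter (· < i)).card with hlab
  set lab' : ℕ → ℕ := fun i => (H'.filter (· < i)).card with hlab'
  set A : ℕ → Finset ℕ := fun p => ((Finset.range n).filter (· ∉ H)).filter fun i => lab i = p
    with hA
  set B : ℕ → Finset ℕ := fun q => ((Finset.range n).filter (· ∉ H')).filter fun i => lab' i = q
    with hB
  set E := meetings n L L' with hEdef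
  -- Pigeonhole over pairs of segments between consecutive elements of `H` and of `H'`. Positions in
  -- `H` or `H'` account for at most `8 * k ^ 2 * n` meetings, and sparse pairs of segments for at
  -- most `160 * k ^ 2 * n`, whence `168`.
  have hdense : ∃ p q, 10 * (2 * k) * ((A p).card + (B q).card) <
      (E.filter fun x => x.1 ∈ A p ∧ x.2 ∈ B q).card := by
    by_contra! hno
    have hcover : E ⊆ (H ×ˢ Finset.range n) ∪ ((Finset.range n ×ˢ H') ∪
        (Finset.range (4 * k) ×ˢ Finset.range (4 * k)).biUnion fun t =>
          E.filter fun x => x.1 ∈ A t.1 ∧ x.2 ∈ B t.2) := by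
      intro x hx
      obtain ⟨⟨h1, h2⟩, -⟩ := mem_meetings.1 hx
      simp only [Finset.mem_union, Finset.mem_product, Finset.mem_biUnion, Finset.mem_filter,
        Finset.mem_range, hA, hB]
      by_cases h3 : x.1 ∈ H
      · exact Or.inl ⟨h3, h2⟩
      by_cases h4 : x.2 ∈ H'
      · exact Or.inr (Or.inl ⟨h1, h4⟩)
      refine Or.inr (Or.inr ⟨(lab x.1, lab' x.2), ⟨?_, ?_⟩, hx, ⟨⟨h1, h3⟩, rfl⟩, ⟨h2, h4⟩, rfl⟩)
      · exact lt_of_le_of_lt (Finset.card_filter_le _ _) hHc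
      · exact lt_of_le_of_lt (Finset.card_filter_le _ _) hHc'
    have hle := (Finset.card_le_card hcover).trans ((Finset.card_union_le _ _).trans
      (Nat.add_le_add_left (Finset.card_union_le _ _) _))
    rw [Finset.card_product, Finset.card_product, Finset.card_range] at hle
    have hsum : ((Finset.range (4 * k) ×ˢ Finset.range (4 * k)).biUnion fun t =>
          E.filter fun x => x.1 ∈ A t.1 ∧ x.2 ∈ B t.2).card ≤ 160 * k ^ 2 * n := by
      refine Finset.card_biUnion_le.trans ((Finset.sum_le_sum fun t _ => hno t.1 t.2).trans ?_)
      rw [← Finset.mul_sum, Finset.sum_product]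
      simp only [Finset.sum_add_distrib, Finset.sum_const, Finset.card_range, smul_eq_mul,
        ← Finset.mul_sum]
      have e1 := sum_card_filter_eq_le ((Finset.range n).filter (· ∉ H)) lab (4 * k)
      have e2 := sum_card_filter_eq_le ((Finset.range n).filter (· ∉ H')) lab' (4 * k)
      have e3 := Finset.card_filter_le (Finset.range n) (· ∉ H)
      have e4 := Finset.card_filter_le (Finset.range n) (· ∉ H')
      rw [Finset.card_range] at e3 e4
      calc _ ≤ 10 * (2 * k) * (4 * k * n + 4 * k * n) :=
            Nat.mul_le_mul_left _ (Nat.add_le_add (Nat.mul_le_mul_left _ (e1.trans e3))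
              (Nat.mul_le_mul_left _ (e2.trans e4)))
        _ = 160 * k ^ 2 * n := by ring
    have e1 : H.card * n ≤ 4 * (k ^ 2 * n) := by
      rw [← mul_assoc]
      exact Nat.mul_le_mul_right _ (by nlinarith)
    have e2 : n * H'.card ≤ 4 * (k ^ 2 * n) := by
      rw [← mul_assoc, mul_comm n]
      exact Nat.mul_le_mul_right _ (by nlinarith)
    rw [mul_assoc] at hE hsum
    omega
  obtain ⟨p, q, hpq⟩ := hdense
  obtain ⟨T, a, b, c, d, hT, hbox, hsep⟩ := exists_decreasing_boxes (2 * k) (A := A p) (B := B q)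
    (E := E.filter fun x => x.1 ∈ A p ∧ x.2 ∈ B q) (fun x hx => Finset.mem_product.2
      (Finset.mem_filter.1 hx).2) hpq
  have hAB : ∀ t ∈ T, (a t ∈ A p ∧ b t ∈ A p) ∧ (c t ∈ B q ∧ d t ∈ B q) ∧
      ¬ Disjoint (L (a t)) (L' (d t)) ∧ ¬ Disjoint (L (b t)) (L' (c t)) := by
    intro t ht
    obtain ⟨-, -, h1, h2⟩ := hbox t ht
    rw [Finset.mem_filter] at h1 h2
    exact ⟨⟨h1.2.1, h2.2.1⟩, ⟨h2.2.2, h1.2.2⟩, (mem_meetings.1 h1.1).2, (mem_meetings.1 h2.1).2⟩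
  have hseg : ∀ i ∈ A p, ∀ j ∈ A p, j < n ∧ ∀ x ∈ H, i ≤ x → j < x := by
    intro i hi j hj
    simp only [hA, Finset.mem_filter, Finset.mem_range] at hi hj
    exact ⟨hj.1.1, forall_le_of_card_filter_eq hj.1.2 (hi.2.trans hj.2.symm)⟩
  have hseg' : ∀ i ∈ B q, ∀ j ∈ B q, j < n ∧ ∀ x ∈ H', i ≤ x → j < x := by
    intro i hi j hj
    simp only [hB, Finset.mem_filter, Finset.mem_range] at hi hj
    exact ⟨hj.1.1, forall_le_of_card_filter_eq hj.1.2 (hi.2.trans hj.2.symm)⟩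
  -- All positions of these boxes lie in one segment, and the thread has no cycle there because `H`
  -- meets every cyclic stretch. So forward and connecting paths together form a single layer.
  have hdis : ∀ s ∈ T, ∀ t ∈ T, b s < a t →
      Disjoint (threadPart L M (a s) (b s)) (threadPart L M (a t) (b t)) := by
    intro s hs t ht hlt
    obtain ⟨hn, hx⟩ := hseg _ (hAB s hs).1.1 _ (hAB t ht).1.2
    refine h.disjoint_threadPart hlt hn (fun f hf haf => (hx f (hFH hf) haf).le) fun hc => ?_
    have h1 := (hbox s hs).1
    have h2 := (hbox t ht).1
    obtain ⟨x, hxH, hx1, hx2⟩ := hH _ _ (by omega) hn hc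
    have := hx x hxH hx1
    omega
  have hdis' : ∀ s ∈ T, ∀ t ∈ T, d s < c t →
      Disjoint (threadPart L' M' (c s) (d s)) (threadPart L' M' (c t) (d t)) := by
    intro s hs t ht hlt
    obtain ⟨hn, hx⟩ := hseg' _ (hAB s hs).2.1.1 _ (hAB t ht).2.1.2
    refine h'.disjoint_threadPart hlt hn (fun f hf haf => (hx f (hFH' hf) haf).le) fun hc => ?_
    have h1 := (hbox s hs).2.1
    have h2 := (hbox t ht).2.1
    obtain ⟨x, hxH, hx1, hx2⟩ := hH' _ _ (by omega) hn hc
    have := hx x hxH hx1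
    omega
  refine hk (hasCyclePacking_of_layers (by omega) T
    ![fun t => threadPart L M (a t) (b t), fun t => threadPart L' M' (c t) (d t)] ?_ ?_ hT.ge)
  · intro i s hs t ht hst
    obtain ⟨h1, h2⟩ := hsep s hs t ht hst
    fin_cases i
    · rcases h1 with h1 | h1
      · exact hdis s hs t ht h1
      · exact (hdis t ht s hs h1).symm
    · rcases h2 with h2 | h2
      · exact hdis' s hs t ht h2
      · exact (hdis' t ht s hs h2).symm
  · intro t ht
    obtain ⟨⟨ha, hb⟩, ⟨hc, hd⟩, had, hbc⟩ := hAB t ht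
    obtain ⟨hbn, hx⟩ := hseg _ ha _ hb
    obtain ⟨hdn, hx'⟩ := hseg' _ hc _ hd
    refine (h.hasCycleIn_of_crossing h' (hbox t ht).1 hbn (hbox t ht).2.1 hdn
      (fun f hf haf => (hx f (hFH hf) haf).le) (fun f hf haf => (hx' f (hFH' hf) haf).le)
      had hbc).mono ?_
    rintro v (hv | hv)
    · exact Set.mem_iUnion.2 ⟨0, hv⟩
    · exact Set.mem_iUnion.2 ⟨1, hv⟩

end IsThread

/-! ### From linkages to threads and disjoint representatives -/

theorem IsLinkage.injOn {r : V → V → Prop} {A B : Finset V} {S : V → Set V} {e : V → V}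
    (h : IsLinkage r A B S e) {a a' : V} (ha : a ∈ A) (ha' : a' ∈ A) (he : e a = e a') :
    a = a' := by
  by_contra hne
  exact Set.disjoint_left.1 (h.disjoint a ha a' ha' hne) (h.end_mem a ha) (he ▸ h.end_mem a' ha')

/-- A linkage together with a linkage in the opposite direction forms a thread. -/
theorem IsLinkage.exists_isThread [Finite V] [Nonempty V] {r : V → V → Prop} {A B : Finset V}
    {S S' : V → Set V} {e e' : V → V} (h : IsLinkage r A B S e) (h' : IsLinkage r B A S' e')
    (hAB : Disjoint A B) :
    ∃ (x : ℕ → V) (F : Finset ℕ), (∀ a ∈ A, ∃ i < A.card, x i = a) ∧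
      IsThread r A.card F (fun i => S (x i)) (fun i => S' (e (x i))) x fun i => e (x i) := by
  classical
  -- Following a forward path and then a return path permutes `A`; the thread lists the orbits of
  -- this permutation. The identity off `A` only makes the map injective everywhere.
  let σ : V → V := fun v => if v ∈ A then e' (e v) else v
  have hσA : ∀ a ∈ A, σ a = e' (e a) := fun a ha => if_pos ha
  have hmaps : ∀ a ∈ A, σ a ∈ A := fun a ha => by
    rw [hσA a ha]
    exact h'.end_target _ (h.end_target a ha)
  have hinj : Function.Injective σ := by
    intro a b hab
    by_cases ha : a ∈ A <;> by_cases hb : b ∈ A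
    · rw [hσA a ha, hσA b hb] at hab
      exact h.injOn ha hb (h'.injOn (h.end_target a ha) (h.end_target b hb) hab)
    · have := hmaps a ha
      rw [hab] at this
      simp only [σ, hb, if_false] at this
    · have := hmaps b hb
      rw [← hab] at this
      simp only [σ, ha, if_false] at this
    · simpa only [σ, ha, hb, if_false] using hab
  obtain ⟨x, F, hxA, hxinj, hstep, hF⟩ := exists_orbit_enumeration hinj A.card A rfl hmaps
  have hxB : ∀ i < A.card, e (x i) ∈ B := fun i hi => h.end_target _ (hxA i hi)
  refine ⟨x, F, ?_, ⟨fun i hi => h.start_mem _ (hxA i hi), ?_,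
    fun i hi => h.reach_start _ (hxA i hi), fun i hi => h.reach_end _ (hxA i hi),
    fun i hi => h'.start_mem _ (hxB i hi), fun i hi => h'.reach_start _ (hxB i hi), ?_, ?_, ?_, ?_⟩⟩
  · have himg : (Finset.range A.card).image x = A := by
      refine Finset.eq_of_subset_of_card_le ?_ ?_
      · intro y hy
        obtain ⟨i, hi, rfl⟩ := Finset.mem_image.1 hy
        exact hxA i (Finset.mem_range.1 hi)
      · rw [Finset.card_image_of_injOn, Finset.card_range]
        intro i hi j hj hij
        by_contra hne
        exact hxinj i (by simpa using hi) j (by simpa using hj) hne hij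
    intro a ha
    rw [← himg] at ha
    obtain ⟨i, hi, rfl⟩ := Finset.mem_image.1 ha
    exact ⟨i, Finset.mem_range.1 hi, rfl⟩
  · intro i hi heq
    exact Finset.disjoint_left.1 hAB (hxA i hi) (heq ▸ hxB i hi)
  · intro i hi hiF
    obtain ⟨h1, h2⟩ := hstep i hi hiF
    rw [hσA _ (hxA i hi)] at h2
    refine ⟨h1, fun v hv => ?_⟩
    rw [← h2]
    exact h'.reach_end _ (hxB i hi) v hv
  · intro f hf
    obtain ⟨hfn, g, hgf, hgF, hfg⟩ := hF f hf
    rw [hσA _ (hxA f hfn)] at hfg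
    refine ⟨hfn, g, hgf, hgF, ?_⟩
    rw [← hfg]
    exact h'.reach_end _ (hxB f hfn) _ (h'.start_mem _ (hxB f hfn))
  · intro i hi j hj hij
    exact h.disjoint _ (hxA i hi) _ (hxA j hj) (hxinj i hi j hj hij)
  · intro i hi j hj hij
    refine h'.disjoint _ (hxB i hi) _ (hxB j hj) fun heq => ?_
    exact hxinj i hi j hj hij (h.injOn (hxA i hi) (hxA j hj) heq)

/-- A finite graph of bounded degree contains a large independent set. -/
theorem exists_independent {α : Type*} {conf : α → α → Prop} (hrefl : ∀ a, conf a a)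
    (hsymm : ∀ a b, conf a b → conf b a) {M : ℕ} (hM : 0 < M) (K : ℕ) (Ω : Finset α)
    [∀ a, DecidablePred (conf a)]
    (hdeg : ∀ a ∈ Ω, (Ω.filter (conf a)).card ≤ M) (hcard : K * M ≤ Ω.card) :
    ∃ T ⊆ Ω, T.card = K ∧ ∀ a ∈ T, ∀ b ∈ T, a ≠ b → ¬ conf a b := by
  classical
  induction K generalizing Ω with
  | zero => exact ⟨∅, by simp⟩
  | succ K ih =>
    rw [Nat.succ_mul] at hcard
    obtain ⟨a, ha⟩ : Ω.Nonempty := Finset.card_pos.1 (by omega)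
    have hsplit := Finset.card_filter_add_card_filter_not (s := Ω) (conf a)
    have hda := hdeg a ha
    obtain ⟨T, hT, hTc, hTi⟩ := ih (Ω.filter fun b => ¬ conf a b) (fun b hb =>
      (Finset.card_le_card (Finset.filter_subset_filter _ (Finset.filter_subset _ _))).trans
        (hdeg b (Finset.mem_filter.1 hb).1)) (by omega)
    have hna : ∀ b ∈ T, ¬ conf a b := fun b hb => (Finset.mem_filter.1 (hT hb)).2
    have haT : a ∉ T := fun h => hna a h (hrefl a)
    refine ⟨insert a T, Finset.insert_subset ha (hT.trans (Finset.filter_subset _ _)), by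
      rw [Finset.card_insert_of_notMem haT, hTc], ?_⟩
    intro b hb c hc hbc
    rcases Finset.mem_insert.1 hb with rfl | hbT <;> rcases Finset.mem_insert.1 hc with rfl | hcT
    · exact absurd rfl hbc
    · exact hna c hcT
    · exact fun h => hna b hbT (hsymm _ _ h)
    · exact hTi b hbT c hcT hbc

open Classical in
/-- From `16 k` families of `16 k D` sets with few intersections between different families one can
choose `2 k` disjoint sets from different families. -/
theorem exists_disjoint_representatives {A : ℕ → Finset V} {S : ℕ → V → Set V} {k D : ℕ}
    (hk : 0 < k) (hD : 0 < D) (hA : ∀ t < 16 * k, (A t).card = 16 * k * D)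
    (hS : ∀ t < 16 * k, ∀ s < 16 * k, t ≠ s →
      ((A t ×ˢ A s).filter fun x => ¬ Disjoint (S t x.1) (S s x.2)).card ≤
        D * (16 * k * D)) :
    ∃ T : Finset (Σ _ : ℕ, V), T.card = 2 * k ∧ (∀ v ∈ T, v.1 < 16 * k ∧ v.2 ∈ A v.1) ∧
      ∀ u ∈ T, ∀ v ∈ T, u ≠ v → u.1 ≠ v.1 ∧ Disjoint (S u.1 u.2) (S v.1 v.2) := by
  set m := 16 * k with hm
  set b := m * D with hb
  have hb0 : 0 < b := Nat.mul_pos (by omega) hD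
  let conf : (Σ _ : ℕ, V) → (Σ _ : ℕ, V) → Prop := fun u v =>
    u.1 = v.1 ∨ ¬ Disjoint (S u.1 u.2) (S v.1 v.2)
  set Ω := (Finset.range m).sigma A with hΩ
  have hΩc : Ω.card = m * b := by
    rw [hΩ, Finset.card_sigma, Finset.sum_congr rfl fun t ht => hA t (Finset.mem_range.1 ht)]
    simp
  have hpair : ∀ t < m, ∀ s < m, ∑ a ∈ A t, ∑ a' ∈ A s,
      (if conf ⟨t, a⟩ ⟨s, a'⟩ then 1 else 0) ≤ (if s = t then b * b else 0) + D * b := by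
    intro t ht s hs
    by_cases hst : s = t
    · subst hst
      rw [if_pos rfl]
      refine le_trans ?_ (Nat.le_add_right _ _)
      calc _ ≤ ∑ a ∈ A s, ∑ a' ∈ A s, 1 := Finset.sum_le_sum fun a _ => Finset.sum_le_sum
              fun a' _ => by split_ifs <;> omega
        _ = b * b := by simp [hA s hs]
    · rw [if_neg hst, zero_add]
      refine le_trans ?_ (hS t ht s hs (Ne.symm hst))
      rw [Finset.card_filter, Finset.sum_product]
      refine Finset.sum_le_sum fun a _ => Finset.sum_le_sum fun a' _ => ?_
      simp only [conf, Ne.symm hst, false_or]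
      exact le_rfl
  -- For each family, conflicts inside it contribute `b * b`, and those with all `m` families
  -- another `m * (D * b) = b * b`. The average number of conflicts is thus at most `2 * b`, so at
  -- least half of the `m * b` members have at most `4 * b`; with `m = 16 * k` that half is `2 * k *
  -- (4 * b)`.
  have htotal : ∑ v ∈ Ω, (Ω.filter (conf v)).card ≤ m * (2 * (b * b)) := by
    simp only [Finset.card_filter]
    rw [hΩ, Finset.sum_sigma]
    refine (Finset.sum_le_card_nsmul _ _ (2 * (b * b)) fun t ht => ?_).trans (by simp)
    rw [Finset.mem_range] at ht
    simp only [Finset.sum_sigma]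
    rw [Finset.sum_comm]
    refine (Finset.sum_le_sum fun s hs => hpair t ht s (Finset.mem_range.1 hs)).trans ?_
    rw [Finset.sum_add_distrib, Finset.sum_ite_eq' (Finset.range m) t]
    simp only [Finset.mem_range, ht, if_true, Finset.sum_const, Finset.card_range, smul_eq_mul]
    have : m * (D * b) = b * b := by rw [← mul_assoc, ← hb]
    omega
  set light := Ω.filter fun v => (Ω.filter (conf v)).card ≤ 4 * b with hlight
  have hsplit := Finset.card_filter_add_card_filter_not (s := Ω)
    (fun v => (Ω.filter (conf v)).card ≤ 4 * b)
  have hheavy : (Ω.filter fun v => ¬ (Ω.filter (conf v)).card ≤ 4 * b).card * (4 * b) ≤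
      m * (2 * (b * b)) := by
    refine le_trans ?_ htotal
    rw [← smul_eq_mul]
    refine (Finset.card_nsmul_le_sum _ (fun v => (Ω.filter (conf v)).card) _ fun v hv => ?_).trans
      (Finset.sum_le_sum_of_subset (Finset.filter_subset _ _))
    have := (Finset.mem_filter.1 hv).2
    omega
  have hheavy' : (Ω.filter fun v => ¬ (Ω.filter (conf v)).card ≤ 4 * b).card * 2 ≤ m * b := by
    have h1 : (2 * b) * ((Ω.filter fun v => ¬ (Ω.filter (conf v)).card ≤ 4 * b).card * 2) ≤
        (2 * b) * (m * b) := by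
      calc _ = (Ω.filter fun v => ¬ (Ω.filter (conf v)).card ≤ 4 * b).card * (4 * b) := by ring
        _ ≤ _ := hheavy
        _ = _ := by ring
    exact Nat.le_of_mul_le_mul_left h1 (by omega)
  have hcard : 2 * k * (4 * b) ≤ light.card := by
    have h2 : 2 * k * (4 * b) * 2 = m * b := by rw [hm]; ring
    rw [hΩc] at hsplit
    change light.card + _ = _ at hsplit
    omega
  obtain ⟨T, hT, hTc, hTi⟩ := exists_independent (conf := conf) (fun _ => Or.inl rfl)
    (fun u v h => h.imp Eq.symm fun h1 h2 => h1 h2.symm) (M := 4 * b) (by omega) (2 * k) light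
    (fun v hv => (Finset.card_le_card (Finset.filter_subset_filter _
      (Finset.filter_subset _ _))).trans (Finset.mem_filter.1 hv).2) hcard
  refine ⟨T, hTc, fun v hv => ?_, fun u hu v hv huv => ?_⟩
  · have := (Finset.mem_filter.1 (hT hv)).1
    rw [hΩ, Finset.mem_sigma, Finset.mem_range] at this
    exact this
  · have := hTi u hu v hv huv
    simp only [conf, not_or, not_not] at this
    exact this

/-! ### Assembling the packing and the bounds -/

/-- A haven of large order yields a packing, provided that two threads meeting often do. -/
theorem IsHaven.hasCyclePacking [Finite V] {G : Digraph V} {w p k D : ℕ}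
    {β : Finset V → Set V} (h : IsHaven G.Adj w β) (hp : 2 ≤ p) (hk : 0 < k) (hD : 0 < D)
    (hw : 2048 * k ^ 2 * D ≤ w)
    (hdense : ∀ (n : ℕ) (F F' : Finset ℕ) (L M L' M' : ℕ → Set V) (s e s' e' : ℕ → V),
      IsThread G.Adj n F L M s e → IsThread G.Adj n F' L' M' s' e' →
      D * n < (IsThread.meetings n L L').card → G.HasCyclePacking p k) :
    G.HasCyclePacking p k := by
  classical
  have : Nonempty V := (h.nonempty ∅ (by simp)).to_type
  by_contra hno
  set m := 16 * k with hm
  set b := m * D with hb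
  -- Linked sets of size `b` need order `2 * b` in each of the two stretches of each of the `m`
  -- pieces; finding the path costs another factor 2.
  have hmb : 2 * (m * (2 * b + 2 * b)) = 2048 * k ^ 2 * D := by rw [hb, hm]; ring
  have hbm : b ≤ m * b := Nat.le_mul_of_pos_left _ (by omega)
  have hmb' : m * (2 * b + 2 * b) = 4 * (m * b) := by ring
  obtain ⟨l, hl, hnd, hord⟩ := h.exists_path (n := m * (2 * b + 2 * b)) (by omega)
  obtain ⟨Q, Q', hQ, hQdisj⟩ := exists_pieces h.anti h.notMem (2 * b) m l hl hnd hord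
  have hlink : ∀ t, ∃ (A B : Finset V) (S S' : V → Set V) (e e' : V → V), t < m →
      A ⊆ Q' t ∧ B ⊆ Q t ∧ A.card = b ∧ Disjoint A B ∧ IsLinkage G.Adj A B S e ∧
        IsLinkage G.Adj B A S' e' := by
    intro t
    by_cases ht : t < m
    · obtain ⟨q1, q2, q3, -⟩ := hQ t ht
      obtain ⟨A, hAQ, hAc, hAout, hAin⟩ := h.exists_isLinkedTo q2 (n := b) le_rfl (by omega)
      obtain ⟨B, hBQ, hBc, hBout, hBin⟩ := h.exists_isLinkedTo q1 (n := b) le_rfl (by omega)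
      obtain ⟨S, e, hS⟩ := h.exists_isLinkage hAout hBin (hAc.trans hBc.symm) (by omega)
      obtain ⟨S', e', hS'⟩ := h.exists_isLinkage hBout hAin (hBc.trans hAc.symm) (by omega)
      refine ⟨A, B, S, S', e, e', fun _ => ⟨hAQ, hBQ, hAc, ?_, hS, hS'⟩⟩
      rw [Finset.disjoint_left]
      exact fun v hvA hvB => (q3 v (hBQ hvB) v (hAQ hvA)).1 rfl
    · exact ⟨∅, ∅, fun _ => ∅, fun _ => ∅, id, id, fun h => absurd h ht⟩
  choose A B S S' e e' hlink using hlink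
  -- Otherwise the threads built from the two pieces meet often enough for `hdense` to give the
  -- packing.
  have hsparse : ∀ t < m, ∀ s < m, t ≠ s →
      ((A t ×ˢ A s).filter fun x => ¬ Disjoint (S t x.1) (S s x.2)).card ≤ D * b := by
    intro t ht s hs _
    by_contra! hlt
    obtain ⟨-, -, hAt, hABt, hSt, hSt'⟩ := hlink t ht
    obtain ⟨-, -, hAs, hABs, hSs, hSs'⟩ := hlink s hs
    obtain ⟨x, F, hx, hth⟩ := hSt.exists_isThread hSt' hABt
    obtain ⟨y, F', hy, hth'⟩ := hSs.exists_isThread hSs' hABs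
    rw [hAt] at hx hth
    rw [hAs] at hy hth'
    refine hno (hdense b _ _ _ _ _ _ _ _ _ _ hth hth' (hlt.trans_le ?_))
    refine (Finset.card_le_card (t := (IsThread.meetings b (fun i => S t (x i))
      fun i => S s (y i)).image fun z => (x z.1, y z.2)) ?_).trans Finset.card_image_le
    rintro ⟨a, a'⟩ haa
    rw [Finset.mem_filter, Finset.mem_product] at haa
    obtain ⟨i, hi, rfl⟩ := hx a haa.1.1
    obtain ⟨j, hj, rfl⟩ := hy a' haa.1.2
    exact Finset.mem_image.2 ⟨(i, j), IsThread.mem_meetings.2 ⟨⟨hi, hj⟩, haa.2⟩, rfl⟩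
  obtain ⟨T, hTc, hTA, hTdisj⟩ := exists_disjoint_representatives (A := A) (S := S) hk hD
    (fun t ht => (hlink t ht).2.2.1) hsparse
  -- The layers are the pieces of the long path and the chosen linkage paths. Each cycle runs along
  -- its piece from `Q` to `Q'` and returns by its linkage path.
  refine hno ((hasCyclePacking_of_layers (p := 2) (by omega) T
    ![fun v => (Q v.1 ∪ Q' v.1 : Set V), fun v => S v.1 v.2] ?_ ?_ hTc.ge).mono hp le_rfl)
  · intro i u hu v hv huv
    obtain ⟨h1, h2⟩ := hTdisj u hu v hv huv
    fin_cases i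
    · exact hQdisj _ (hTA u hu).1 _ (hTA v hv).1 h1
    · exact h2
  · intro v hv
    obtain ⟨hvm, hvA⟩ := hTA v hv
    obtain ⟨hAQ, hBQ, -, -, hS, -⟩ := hlink v.1 hvm
    have hend := hS.end_target _ hvA
    obtain ⟨hne, hback⟩ := (hQ v.1 hvm).2.2.1 _ (hBQ hend) _ (hAQ hvA)
    have hforth := hS.reach_start _ hvA _ (hS.end_mem _ hvA)
    have hu : (Q v.1 ∪ Q' v.1 : Set V) ∪ S v.1 v.2 ⊆
        ⋃ i, ![fun v : (Σ _ : ℕ, V) => (Q v.1 ∪ Q' v.1 : Set V), fun v => S v.1 v.2] i v := by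
      rintro x (hx | hx)
      · exact Set.mem_iUnion.2 ⟨0, hx⟩
      · exact Set.mem_iUnion.2 ⟨1, hx⟩
    exact hasCycleIn_of_transGen (((hback.mono (Set.subset_union_left.trans hu)).transGen
      hne).trans_left (hforth.mono (Set.subset_union_right.trans hu)))

theorem feedback_of_packing [Finite V] {p q C : ℕ} (hp : 0 < p)
    (H : ∀ (G : Digraph V) (β : Finset V → Set V) (j : ℕ), 1 ≤ j →
      IsHaven G.Adj (C * j ^ (q + 1)) β → G.HasCyclePacking p (j + 1))
    (G : Digraph V) (k : ℕ) (hG : ¬ G.HasCyclePacking p k) :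
    ∃ X : Finset V, G.IsFeedbackVertexSet X ∧ X.card ≤ C * k ^ (q + 2) := by
  rcases k with _ | j
  · exact absurd ⟨∅, rfl, by simp, by simp⟩ hG
  · obtain ⟨X, hX, hc⟩ := exists_isFeedbackVertexSet hp H j G hG
    exact ⟨X, hX, hc.trans (Nat.mul_le_mul_left _ (Nat.pow_le_pow_left (Nat.le_succ j) _))⟩

/-- With `D` linear in `k` the haven needs cubic order, and the induction adds one more power.
Replacing `j + 1` by `2 * j` costs the factor 8 in the constant. -/
theorem exists_feedback_quarter [Finite V] (G : Digraph V) (k : ℕ)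
    (hG : ¬ G.HasCyclePacking 4 k) :
    ∃ X : Finset V, G.IsFeedbackVertexSet X ∧ X.card ≤ 2621440 * k ^ 4 := by
  refine feedback_of_packing (q := 2) (by omega) (fun G β j hj hβ => ?_) G k hG
  refine hβ.hasCyclePacking (D := 160 * (j + 1)) (by omega) (by omega) (by omega) ?_
    fun n F F' L M L' M' s e s' e' h h' hE => h.hasCyclePacking_four h' hE
  calc 2048 * (j + 1) ^ 2 * (160 * (j + 1)) = 327680 * (j + 1) ^ 3 := by ring
    _ ≤ 327680 * (2 * j) ^ 3 := Nat.mul_le_mul_left _ (Nat.pow_le_pow_left (by omega) _)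
    _ = 2621440 * j ^ (2 + 1) := by ring

/-- Here `D` is quadratic in `k`, so the exponent is one higher. The same bound serves `p = 3`,
since a half-integral packing also qualifies there. -/
theorem exists_feedback_half [Finite V] (G : Digraph V) (k : ℕ)
    (hG : ¬ G.HasCyclePacking 2 k) :
    ∃ X : Finset V, G.IsFeedbackVertexSet X ∧ X.card ≤ 5505024 * k ^ 5 := by
  refine feedback_of_packing (q := 3) (by omega) (fun G β j hj hβ => ?_) G k hG
  refine hβ.hasCyclePacking (D := 168 * (j + 1) ^ 2) (by omega) (by omega) (by positivity) ?_
    fun n F F' L M L' M' s e s' e' h h' hE => h.hasCyclePacking_two h' hE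
  calc 2048 * (j + 1) ^ 2 * (168 * (j + 1) ^ 2) = 344064 * (j + 1) ^ 4 := by ring
    _ ≤ 344064 * (2 * j) ^ 4 := Nat.mul_le_mul_left _ (Nat.pow_le_pow_left (by omega) _)
    _ = 5505024 * j ^ (3 + 1) := by ring

end Digraph

theorem theorem1 :
    (∃ C : ℕ, ∀ (V : Type*) [Finite V] (G : Digraph V) (k : ℕ), ¬ G.HasCyclePacking 4 k →
      ∃ X : Finset V, G.IsFeedbackVertexSet X ∧ X.card ≤ C * k ^ 4) ∧
    (∃ C : ℕ, ∀ (V : Type*) [Finite V] (G : Digraph V) (k : ℕ), ¬ G.HasCyclePacking 3 k →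
      ∃ X : Finset V, G.IsFeedbackVertexSet X ∧ X.card ≤ C * k ^ 5) ∧
    (∃ C : ℕ, ∀ (V : Type*) [Finite V] (G : Digraph V) (k : ℕ), ¬ G.HasCyclePacking 2 k →
      ∃ X : Finset V, G.IsFeedbackVertexSet X ∧ X.card ≤ C * k ^ 6) := by
  refine ⟨⟨2621440, fun V _ G k hG => Digraph.exists_feedback_quarter G k hG⟩,
    ⟨5505024, fun V _ G k hG => Digraph.exists_feedback_half G k fun h =>
      hG (h.mono (by omega) le_rfl)⟩, ⟨5505024, fun V _ G k hG => ?_⟩⟩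
  obtain ⟨X, hX, hc⟩ := Digraph.exists_feedback_half G k hG
  refine ⟨X, hX, hc.trans (Nat.mul_le_mul_left _ ?_)⟩
  rcases Nat.eq_zero_or_pos k with rfl | hk
  · simp
  · exact Nat.pow_le_pow_right hk (by omega)
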